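/- Let $\nu$ be a finite Borel measure on $(0,1)$ and let $\Lambda$ be Lebesgue measure. For $n\ge 1$ and $q\in\mathbb R$ let $$\beta_n(q)=\frac{1}{\log 2^n}\log\sum_{C}\nu(C)^q,$$ where $C$ runs over the intervals $((k-1)2^{-n},k2^{-n}]$, $1\le k\le 2^n$, with $\nu(C)>0$, and let $\beta_\nu(q)=\limsup_{n\to\infty}\beta_n(q)$ be the $L^q$-spectrum of $\nu$. For $\nu\neq 0$ and all large $n$ the function $\beta_n$ has a unique fixed point $q_n$; put $\overline q_\nu=\limsup_{n\to\infty} q_n$. The measure $\nu$ is called $L^q$-regular if either there is $\varepsilon>0$ with $\beta_\nu(q)=\liminf_{n\to\infty}\beta_n(q)$ for all $q\in(\overline q_\nu-\varepsilon,\overline q_\nu)$, or $\beta_\nu(\overline q_\nu)=\liminf_{n\to\infty}\beta_n(\overline q_\nu)$ and $\beta_\nu$ is differentiable at $\overline q_\nu$. Let $H^1_0(0,1)$ be the space of functions $f:[0,1]\to\mathbb R$ with $f(0)=f(1)=0$ for which there is $\nabla f\in L^2([0,1],\Lambda)$ with $f(x)=\int_0^x\nabla f\,d\Lambda$ for all $x\in[0,1]$,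 and let $\mathcal D_\nu$ be the set of those $f\in H^1_0(0,1)$ that are affine linear on each connected component of $[0,1]\setminus\operatorname{supp}\nu$. A real number $\lambda$ is an eigenvalue (of the Kreĭn–Feller operator of $\nu$ with Dirichlet boundary conditions on $[0,1]$) if there is $f\in\mathcal D_\nu\setminus\{0\}$ with $$\int_{(0,1)}\nabla f\,\nabla g\,d\Lambda=\lambda\int fg\,d\nu\qquad\text{for all }g\in\mathcal D_\nu .$$ Let $N_\nu(x)$ be the number of eigenvalues $\le x$, counted with multiplicity, and define the lower and upper spectral dimensions of $\nu$ by $$\underline s_\nu=\liminf_{x\to\infty}\frac{\log N_\nu(x)}{\log x},\qquad \overline s_\nu=\limsup_{x\to\infty}\frac{\log N_\nu(x)}{\log x}.$$ If they coincide, their common value is called the spectral dimension of $\nu$. Suppose that the absolutely continuous part of $\nu$ with respect to $\Lambda$ is not zero. Then for every $q\in[0,1]$ the limit $\lim_{n\to\infty}\beta_n(q)$ exists and $$\beta_\nu(q)=\lim_{n\to\infty}\beta_n(q)=1-q .$$ In particular, $\nu$ is $L^q$-regular, and its spectral dimension exists and equals $1/2$. -/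

import Mathlib

open MeasureTheory Filter Topology Set
open scoped ENNReal

noncomputable section

namespace KreinFeller

/-! Throughout, a finite Borel measure on `(0,1)` is a finite measure `ν` on `ℝ` which gives
no mass to the complement of `(0,1)`.  A function on `[0,1]` that vanishes at `0` and `1` is
identified with its extension by zero to the real line. -/

/-- `g` is a weak derivative of `f` on `[0,1]`: `g ∈ L²([0,1])` and
`f x = f 0 + ∫_{[0,x]} g` for `x ∈ [0,1]`. -/
def IsWeakDeriv (f g : ℝ → ℝ) : Prop :=
  MemLp g 2 (volume.restrict (Icc 0 1)) ∧
    ∀ x ∈ Icc (0 : ℝ) 1, f x = f 0 + ∫ t in Icc 0 x, g t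

/-- The Sobolev space `H¹₀(0,1)` (functions extended by zero outside `(0,1)`). -/
def H10 : Set (ℝ → ℝ) :=
  {f | (∃ g, IsWeakDeriv f g) ∧ ∀ x, x ∉ Ioo (0 : ℝ) 1 → f x = 0}

open Classical in
/-- The weak derivative of `f` (unique up to Lebesgue null sets in `[0,1]`). -/
def weakDeriv (f : ℝ → ℝ) : ℝ → ℝ :=
  if h : ∃ g, IsWeakDeriv f g then h.choose else 0

/-- `f` is affine linear on every connected component of `[0,1] \ supp ν`. -/
def AffineOffSupport (ν : Measure ℝ) (f : ℝ → ℝ) : Prop :=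
  ∀ x ∈ Icc (0 : ℝ) 1 \ ν.support, ∃ m c : ℝ,
    ∀ y ∈ connectedComponentIn (Icc (0 : ℝ) 1 \ ν.support) x, f y = m * y + c

/-- The Dirichlet domain of the form: the functions in `H¹₀(0,1)` (these are continuous) that
are affine linear on the components of `[0,1] \ supp ν`. -/
def formDomain (ν : Measure ℝ) : Set (ℝ → ℝ) :=
  {f | f ∈ H10 ∧ AffineOffSupport ν f}

/-- The form `ℰ(f, g) = ∫_{(0,1)} ∇f ∇g dΛ`. -/
def energy (f g : ℝ → ℝ) : ℝ :=
  ∫ x in Ioo (0 : ℝ) 1, weakDeriv f x * weakDeriv g x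

/-- `f` is an eigenfunction, with eigenvalue `l`, of the form `ℰ_ν`, equivalently of the
Kreĭn-Feller operator `Δ_ν`, with Dirichlet boundary conditions on `[0,1]`. -/
def IsEigenfunction (ν : Measure ℝ) (l : ℝ) (f : ℝ → ℝ) : Prop :=
  f ∈ formDomain ν ∧ f ≠ 0 ∧
    ∀ g ∈ formDomain ν, energy f g = l * ∫ x, f x * g x ∂ν

/-- The multiplicity of `l`: the dimension of the space spanned by the eigenfunctions with
eigenvalue `l`; it is `0` if `l` is not an eigenvalue. -/
def multiplicity (ν : Measure ℝ) (l : ℝ) : ℕ∞ :=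
  Cardinal.toENat (Module.rank ℝ (Submodule.span ℝ {f | IsEigenfunction ν l f}))

/-- The eigenvalue counting function: the number of eigenvalues not exceeding `x`, counted
with multiplicity. -/
def eigenvalueCount (ν : Measure ℝ) (x : ℝ) : ℝ≥0∞ :=
  ∑' l : Iic x, ((multiplicity ν (l : ℝ) : ℕ∞) : ℝ≥0∞)

/-- The lower spectral dimension `liminf_{x → ∞} log N_ν(x) / log x`, with `log 0 = -∞`. -/
def lowerSpectralDim (ν : Measure ℝ) : EReal :=
  liminf (fun x : ℝ => ENNReal.log (eigenvalueCount ν x) / ((Real.log x : ℝ) : EReal)) atTop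

/-- The upper spectral dimension `limsup_{x → ∞} log N_ν(x) / log x`, with `log 0 = -∞`. -/
def upperSpectralDim (ν : Measure ℝ) : EReal :=
  limsup (fun x : ℝ => ENNReal.log (eigenvalueCount ν x) / ((Real.log x : ℝ) : EReal)) atTop

/-- The spectral dimension of `ν` exists and equals `s`. -/
def HasSpectralDim (ν : Measure ℝ) (s : ℝ) : Prop :=
  lowerSpectralDim ν = (s : EReal) ∧ upperSpectralDim ν = (s : EReal)

/-- The dyadic interval `((k-1)2⁻ⁿ, k2⁻ⁿ]`. -/
def dyadic (n k : ℕ) : Set ℝ :=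
  Ioc (((k : ℝ) - 1) / 2 ^ n) ((k : ℝ) / 2 ^ n)

open Classical in
/-- `β_n(q) = (log 2ⁿ)⁻¹ log ∑ ν(C)^q`, where `C` runs over the dyadic intervals of level `n`
in `(0,1]` with `ν(C) > 0` (meaningful for `n ≥ 1`). -/
def betaLevel (ν : Measure ℝ) (n : ℕ) (q : ℝ) : ℝ :=
  Real.log (∑ k ∈ (Finset.Icc 1 (2 ^ n)).filter (fun k => 0 < ν (dyadic n k)),
    (ν.real (dyadic n k)) ^ q) / Real.log (2 ^ n)

/-- The `L^q`-spectrum `β_ν(q) = limsup_n β_n(q)`. -/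
def lqSpectrum (ν : Measure ℝ) (q : ℝ) : EReal :=
  limsup (fun n : ℕ => ((betaLevel ν n q : ℝ) : EReal)) atTop

/-- `liminf_n β_n(q)`. -/
def lowerLqSpectrum (ν : Measure ℝ) (q : ℝ) : EReal :=
  liminf (fun n : ℕ => ((betaLevel ν n q : ℝ) : EReal)) atTop

/-- The fixed point of `β_n`.  For a nonzero finite measure on `(0,1)` it exists and is unique
as soon as `ν((0,1)) < 2ⁿ`, hence for all large `n`. -/
def fixedPoint (ν : Measure ℝ) (n : ℕ) : ℝ :=
  Classical.epsilon (fun q : ℝ => betaLevel ν n q = q)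

/-- `q̄_ν`, the limit superior of the fixed points of `β_n` (a bounded sequence if `ν` is a
nonzero finite measure on `(0,1)`). -/
def upperFixedPoint (ν : Measure ℝ) : ℝ :=
  limsup (fun n : ℕ => fixedPoint ν n) atTop

/-- The `L^q`-spectrum is finite near `q` and differentiable at `q`. -/
def LqSpectrumDifferentiableAt (ν : Measure ℝ) (q : ℝ) : Prop :=
  (∀ᶠ t in 𝓝 q, lqSpectrum ν t ≠ ⊤ ∧ lqSpectrum ν t ≠ ⊥) ∧
    DifferentiableAt ℝ (fun t => (lqSpectrum ν t).toReal) q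

/-- `L^q`-regularity: `β_ν = liminf_n β_n` on a left neighbourhood of `q̄_ν`, or at `q̄_ν`
itself with `β_ν` differentiable there. -/
def IsLqRegular (ν : Measure ℝ) : Prop :=
  (∃ ε > 0, ∀ q ∈ Ioo (upperFixedPoint ν - ε) (upperFixedPoint ν),
      lqSpectrum ν q = lowerLqSpectrum ν q) ∨
    (lqSpectrum ν (upperFixedPoint ν) = lowerLqSpectrum ν (upperFixedPoint ν) ∧
      LqSpectrumDifferentiableAt ν (upperFixedPoint ν))

end KreinFeller

end

/-!
A measure with an absolutely continuous part dominates a nonzero measure `ρ ≤ Λ`.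

Since `ρ(C) ≤ 2⁻ⁿ` on dyadic intervals, `∑ ν(C)^q ≥ ∑ ρ(C)^q ≥ 2^{n(1-q)} ρ((0,1])` for
`q ∈ [0,1]`, while Jensen's inequality gives `∑ ν(C)^q ≤ 2^{n(1-q)} ν((0,1])^q`. Hence
`β_n(q) → 1 - q`, and the fixed points of `β_n` converge to `1/2`.

Passing from functions to their derivatives turns the eigenvalue problem into that of a compact
positive operator `G` on `L²([0,1])`, the eigenvalue `λ` corresponding to the eigenvalue `λ⁻¹` of
`G`, and `⟪G u, u⟫` is the squared `L²(ν)` norm of the function with derivative `u`. By the min-max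
principle, the number of eigenvalues `≤ x` is bounded from below by test functions and from above by
linear constraints:
* a positive proportion of the `2ⁿ` dyadic intervals of level `n` carries `ρ`-mass comparable to
  `2⁻ⁿ`; their tent functions have disjoint interiors of support and `⟪G u, u⟫ ≳ 4⁻ⁿ ‖u‖²`, which
  gives `≳ √x` eigenvalues `≤ x` for `x ≈ 4ⁿ`;
* cutting `(0,1)` into `m` intervals whose length and whose `ν`-mass are `≲ 1/m`, a function that
  vanishes at the division points satisfies `⟪G u, u⟫ ≲ m⁻² ‖u‖²`, which leaves at most `m`
  eigenvalues `≤ x` for `x ≈ m²`.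
-/

open scoped RealInnerProductSpace

namespace KreinFeller

/-! ### Moment sums and fixed points -/

theorem tendsto_log_div_log_of_rpow_bounds {ι : Type*} {l : Filter ι} {x S : ι → ℝ} {A B s : ℝ}
    (hx : Tendsto x l atTop) (hA : 0 < A) (hlower : ∀ᶠ i in l, A * x i ^ s ≤ S i)
    (hupper : ∀ᶠ i in l, S i ≤ B * x i ^ s) :
    Tendsto (fun i => Real.log (S i) / Real.log (x i)) l (𝓝 s) := by
  have hlog : Tendsto (fun i => Real.log (x i)) l atTop := Real.tendsto_log_atTop.comp hx
  have hlim (C : ℝ) : Tendsto (fun i => C / Real.log (x i) + s) l (𝓝 s) := by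
    simpa using (hlog.const_div_atTop C).add_const s
  have log_bound {C y : ℝ} (hC : 0 < C) (hy : 1 < y) :
      Real.log (C * y ^ s) / Real.log y = Real.log C / Real.log y + s := by
    have := (Real.log_pos hy).ne'
    rw [Real.log_mul hC.ne' (by positivity), Real.log_rpow (by positivity)]
    field_simp
  refine tendsto_of_tendsto_of_tendsto_of_le_of_le' (hlim (Real.log A)) (hlim (Real.log B)) ?_ ?_
  · filter_upwards [hlower, hx.eventually_gt_atTop 1] with i hi h1
    rw [← log_bound hA h1]
    have := Real.log_pos h1
    gcongr
  · filter_upwards [hlower, hupper, hx.eventually_gt_atTop 1] with i hi hi' h1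
    have hpow : 0 < x i ^ s := by positivity
    have hS : 0 < S i := (mul_pos hA hpow).trans_le hi
    rw [← log_bound (pos_of_mul_pos_left (hS.trans_le hi') hpow.le) h1]
    have := Real.log_pos h1
    gcongr

theorem inf_ne_zero_of_withDensity_rnDeriv_ne_zero {α : Type*} [MeasurableSpace α]
    {μ ν : Measure α} [SigmaFinite μ] [SigmaFinite ν] (h : ν.withDensity (μ.rnDeriv ν) ≠ 0) :
    μ ⊓ ν ≠ 0 := by
  intro hinf
  have hsing : μ ⟂ₘ ν := (Measure.mutuallySingular_iff_disjoint).2 (disjoint_iff.2 hinf)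
  exact h ((withDensity_congr_ae ((Measure.rnDeriv_eq_zero μ ν).2 hsing)).trans withDensity_zero)

theorem exists_lebesgue_minorant {ν : Measure ℝ} [IsFiniteMeasure ν]
    (hν : ν (Ioo (0 : ℝ) 1)ᶜ = 0) (hac : volume.withDensity (ν.rnDeriv volume) ≠ 0) :
    ∃ ρ : Measure ℝ, ρ ≤ ν ∧ ρ ≤ volume ∧ 0 < ρ.real (Ioc 0 1) := by
  have hρν : ν ⊓ volume ≤ ν := inf_le_left
  have := isFiniteMeasure_of_le ν hρν
  refine ⟨ν ⊓ volume, hρν, inf_le_right, ENNReal.toReal_pos (fun h => ?_) (measure_ne_top _ _)⟩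
  refine inf_ne_zero_of_withDensity_rnDeriv_ne_zero hac ?_
  rw [← Measure.measure_univ_eq_zero, ← compl_union_self (Ioo (0 : ℝ) 1)]
  exact measure_union_null (Measure.absolutelyContinuous_of_le hρν hν)
    (measure_mono_null Ioo_subset_Ioc_self h)

theorem measurableSet_dyadic (n k : ℕ) : MeasurableSet (dyadic n k) := measurableSet_Ioc

theorem volume_real_dyadic (n k : ℕ) : volume.real (dyadic n k) = ((2 : ℝ) ^ n)⁻¹ := by
  rw [dyadic, Real.volume_real_Ioc_of_le (by gcongr; linarith)]
  ring

theorem pairwise_disjoint_dyadic (n : ℕ) : Pairwise (Function.onFun Disjoint (dyadic n)) := by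
  have hmono : Monotone fun k : ℤ => (k : ℝ) / 2 ^ n := fun i j hij => by dsimp only; gcongr
  intro i j hij
  simpa [Function.onFun, dyadic, Order.pred_eq_sub_one] using
    hmono.pairwise_disjoint_on_Ioc_pred (Nat.cast_injective.ne hij)

theorem biUnion_dyadic (n : ℕ) : ⋃ k ∈ Finset.Icc 1 (2 ^ n), dyadic n k = Ioc 0 1 := by
  have h2 : (0 : ℝ) < 2 ^ n := by positivity
  ext x
  simp only [mem_iUnion, Finset.mem_Icc, dyadic, mem_Ioc, div_lt_iff₀ h2, le_div_iff₀ h2,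
    exists_prop]
  constructor
  · rintro ⟨k, ⟨hk1, hk2⟩, hx1, hx2⟩
    have hk1' : (1 : ℝ) ≤ k := by exact_mod_cast hk1
    have hk2' : (k : ℝ) ≤ 2 ^ n := by exact_mod_cast hk2
    exact ⟨pos_of_mul_pos_left (by linarith) h2.le, le_of_mul_le_mul_right (by linarith) h2⟩
  · rintro ⟨hx0, hx1⟩
    have hpos : 0 < x * 2 ^ n := mul_pos hx0 h2
    refine ⟨⌈x * 2 ^ n⌉₊, ⟨Nat.ceil_pos.2 hpos, Nat.ceil_le.2 ?_⟩, ?_, Nat.le_ceil _⟩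
    · push_cast
      exact mul_le_of_le_one_left h2.le hx1
    · linarith [Nat.ceil_lt_add_one hpos.le]

theorem sum_real_dyadic (ρ : Measure ℝ) [IsFiniteMeasure ρ] (n : ℕ) :
    ∑ k ∈ Finset.Icc 1 (2 ^ n), ρ.real (dyadic n k) = ρ.real (Ioc 0 1) := by
  rw [← biUnion_dyadic n, measureReal_biUnion_finset
    ((pairwise_disjoint_dyadic n).set_pairwise _) fun k _ => measurableSet_dyadic n k]

open Classical in
/-- The indices of the dyadic intervals of level `n` in `(0,1]` that carry mass of `ν`; they index
the sum in `betaLevel`. -/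
noncomputable def chargedIndices (ν : Measure ℝ) (n : ℕ) : Finset ℕ :=
  (Finset.Icc 1 (2 ^ n)).filter fun k => 0 < ν (dyadic n k)

/-- The moment sum `∑ ν(C)^q` over the dyadic intervals `C` of level `n` with `ν(C) > 0`. -/
noncomputable def momentSum (ν : Measure ℝ) (n : ℕ) (q : ℝ) : ℝ :=
  ∑ k ∈ chargedIndices ν n, ν.real (dyadic n k) ^ q

theorem betaLevel_eq (ν : Measure ℝ) (n : ℕ) (q : ℝ) :
    betaLevel ν n q = Real.log (momentSum ν n q) / Real.log (2 ^ n) := rfl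

theorem real_dyadic_pos {ν : Measure ℝ} [IsFiniteMeasure ν] {n k : ℕ}
    (hk : k ∈ chargedIndices ν n) : 0 < ν.real (dyadic n k) := by
  classical
  exact ENNReal.toReal_pos (Finset.mem_filter.1 hk).2.ne' (measure_ne_top _ _)

theorem sum_chargedIndices {ν ρ : Measure ℝ} [IsFiniteMeasure ρ] (hρ : ρ ≤ ν) (n : ℕ) :
    ∑ k ∈ chargedIndices ν n, ρ.real (dyadic n k) = ρ.real (Ioc 0 1) := by
  classical
  rw [← sum_real_dyadic ρ n]
  refine Finset.sum_subset (Finset.filter_subset _ _) fun k hk hk' => ?_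
  have h0 : ν (dyadic n k) = 0 := by
    by_contra hne
    exact hk' (Finset.mem_filter.2 ⟨hk, pos_iff_ne_zero.2 hne⟩)
  rw [measureReal_def, Measure.absolutelyContinuous_of_le hρ h0, ENNReal.toReal_zero]

theorem chargedIndices_nonempty {ν : Measure ℝ} [IsFiniteMeasure ν] (hν : 0 < ν.real (Ioc 0 1))
    (n : ℕ) : (chargedIndices ν n).Nonempty := by
  rw [← sum_chargedIndices le_rfl n] at hν
  exact Finset.nonempty_of_sum_ne_zero hν.ne'

theorem mul_rpow_one_sub_le_rpow {x y q : ℝ} (hx : 0 ≤ x) (hy : 0 < y) (hxy : x ≤ y⁻¹)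
    (hq : q ≤ 1) : x * y ^ (1 - q) ≤ x ^ q := by
  rcases hx.eq_or_lt with rfl | hx
  · rw [zero_mul]
    exact Real.rpow_nonneg le_rfl _
  · calc x * y ^ (1 - q) ≤ x * x⁻¹ ^ (1 - q) := by
          have : y ≤ x⁻¹ := (le_inv_comm₀ hx hy).1 hxy
          gcongr
      _ = x ^ q := by
          rw [Real.inv_rpow hx.le, Real.rpow_sub hx, Real.rpow_one]
          field_simp

theorem le_momentSum {ν ρ : Measure ℝ} [IsFiniteMeasure ν] [IsFiniteMeasure ρ] (hρν : ρ ≤ ν)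
    (hρ : ρ ≤ volume) (n : ℕ) {q : ℝ} (hq : q ∈ Icc (0 : ℝ) 1) :
    ρ.real (Ioc 0 1) * (2 ^ n : ℝ) ^ (1 - q) ≤ momentSum ν n q := by
  rw [← sum_chargedIndices hρν n, Finset.sum_mul]
  refine Finset.sum_le_sum fun k _ => ?_
  have hvol : ρ.real (dyadic n k) ≤ ((2 : ℝ) ^ n)⁻¹ := by
    rw [← volume_real_dyadic n k]
    exact ENNReal.toReal_mono measure_Ioc_lt_top.ne (hρ _)
  have hmono : ρ.real (dyadic n k) ≤ ν.real (dyadic n k) :=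
    ENNReal.toReal_mono (measure_ne_top _ _) (hρν _)
  calc ρ.real (dyadic n k) * (2 ^ n : ℝ) ^ (1 - q) ≤ ρ.real (dyadic n k) ^ q :=
        mul_rpow_one_sub_le_rpow measureReal_nonneg (by positivity) hvol hq.2
    _ ≤ ν.real (dyadic n k) ^ q := Real.rpow_le_rpow measureReal_nonneg hmono hq.1

theorem sum_rpow_le_card_rpow {ι : Type*} (s : Finset ι) {x : ι → ℝ} (hx : ∀ i ∈ s, 0 ≤ x i)
    {q : ℝ} (hq : q ∈ Icc (0 : ℝ) 1) :
    ∑ i ∈ s, x i ^ q ≤ (∑ i ∈ s, x i) ^ q * (s.card : ℝ) ^ (1 - q) := by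
  rcases s.eq_empty_or_nonempty with rfl | hs
  · simpa using mul_nonneg (Real.rpow_nonneg le_rfl q) (Real.rpow_nonneg le_rfl (1 - q))
  have hc : (0 : ℝ) < s.card := by exact_mod_cast hs.card_pos
  have hjensen := (Real.concaveOn_rpow hq.1 hq.2).le_map_sum (t := s) (w := fun _ => (s.card : ℝ)⁻¹)
    (p := x) (fun _ _ => by positivity) (by simp [hc.ne']) hx
  simp only [smul_eq_mul, ← Finset.mul_sum] at hjensen
  rw [Real.mul_rpow (by positivity) (Finset.sum_nonneg hx), Real.inv_rpow hc.le,
    inv_mul_le_iff₀ hc] at hjensen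
  refine hjensen.trans_eq ?_
  rw [Real.rpow_sub hc, Real.rpow_one]
  field_simp

theorem momentSum_le (ν : Measure ℝ) [IsFiniteMeasure ν] (n : ℕ) {q : ℝ}
    (hq : q ∈ Icc (0 : ℝ) 1) :
    momentSum ν n q ≤ ν.real (Ioc 0 1) ^ q * (2 ^ n : ℝ) ^ (1 - q) := by
  classical
  have hcard : ((chargedIndices ν n).card : ℝ) ≤ 2 ^ n := by
    have : (chargedIndices ν n).card ≤ 2 ^ n := (Finset.card_filter_le _ _).trans (by simp)
    exact_mod_cast this
  refine (sum_rpow_le_card_rpow _ (fun _ _ => measureReal_nonneg) hq).trans ?_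
  rw [sum_chargedIndices le_rfl n]
  have : 0 ≤ 1 - q := sub_nonneg.2 hq.2
  gcongr

theorem momentSum_pos {ν : Measure ℝ} [IsFiniteMeasure ν] (hν : 0 < ν.real (Ioc 0 1)) (n : ℕ)
    (q : ℝ) : 0 < momentSum ν n q :=
  Finset.sum_pos (fun _ hk => Real.rpow_pos_of_pos (real_dyadic_pos hk) q)
    (chargedIndices_nonempty hν n)

theorem continuous_betaLevel {ν : Measure ℝ} [IsFiniteMeasure ν] (hν : 0 < ν.real (Ioc 0 1))
    (n : ℕ) : Continuous (betaLevel ν n) := by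
  have hsum : Continuous (momentSum ν n) := continuous_finsetSum _ fun k hk =>
    Real.continuous_const_rpow (real_dyadic_pos hk).ne'
  exact (hsum.log fun q => (momentSum_pos hν n q).ne').div_const _

theorem momentSum_lt_mul_rpow {ν : Measure ℝ} [IsFiniteMeasure ν] (hν : 0 < ν.real (Ioc 0 1))
    {n : ℕ} {M : ℝ} (hM : ν.real univ < M) {q r : ℝ} (hqr : q < r) :
    momentSum ν n r < momentSum ν n q * M ^ (r - q) := by
  rw [momentSum, momentSum, Finset.sum_mul]
  refine Finset.sum_lt_sum_of_nonempty (chargedIndices_nonempty hν n) fun k hk => ?_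
  have hpos := real_dyadic_pos hk
  have hlt : ν.real (dyadic n k) < M := (measureReal_mono (subset_univ _)).trans_lt hM
  calc ν.real (dyadic n k) ^ r = ν.real (dyadic n k) ^ q * ν.real (dyadic n k) ^ (r - q) := by
        rw [← Real.rpow_add hpos, add_sub_cancel]
    _ < ν.real (dyadic n k) ^ q * M ^ (r - q) := by
        have := Real.rpow_lt_rpow hpos.le hlt (sub_pos.2 hqr)
        gcongr

theorem strictAnti_betaLevel_sub {ν : Measure ℝ} [IsFiniteMeasure ν]
    (hν : 0 < ν.real (Ioc 0 1)) {n : ℕ} (hn : n ≠ 0) (hM : ν.real univ < 2 ^ n) :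
    StrictAnti fun q => betaLevel ν n q - q := by
  intro q r hqr
  have hlog : 0 < Real.log (2 ^ n) := Real.log_pos (one_lt_pow₀ one_lt_two hn)
  have h := Real.log_lt_log (momentSum_pos hν n r) (momentSum_lt_mul_rpow hν hM hqr)
  rw [Real.log_mul (momentSum_pos hν n q).ne' (by positivity), Real.log_rpow (by positivity)] at h
  have : betaLevel ν n r < betaLevel ν n q + (r - q) := by
    rw [betaLevel_eq, betaLevel_eq, div_add' _ _ _ hlog.ne']
    gcongr
  dsimp only
  linarith

theorem fixedPoint_mem_Ioo {ν : Measure ℝ} [IsFiniteMeasure ν] (hν : 0 < ν.real (Ioc 0 1))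
    {n : ℕ} (hn : n ≠ 0) (hM : ν.real univ < 2 ^ n) {a b : ℝ} (ha : a < betaLevel ν n a)
    (hb : betaLevel ν n b < b) : fixedPoint ν n ∈ Ioo a b := by
  have hanti := strictAnti_betaLevel_sub hν hn hM
  have hex : ∃ q, betaLevel ν n q = q := by
    obtain ⟨q, hq⟩ := mem_range_of_exists_le_of_exists_ge
      ((continuous_betaLevel hν n).sub continuous_id) (c := 0)
      ⟨b, (sub_neg.2 hb).le⟩ ⟨a, (sub_pos.2 ha).le⟩
    exact ⟨q, sub_eq_zero.1 hq⟩
  have hfix : betaLevel ν n (fixedPoint ν n) - fixedPoint ν n = 0 :=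
    sub_eq_zero.2 (Classical.epsilon_spec hex)
  constructor <;> refine hanti.lt_iff_gt.1 ?_ <;> linarith

section LqSpectrum

variable {ν ρ : Measure ℝ} [IsFiniteMeasure ν] [IsFiniteMeasure ρ] (hρν : ρ ≤ ν)
  (hρ : ρ ≤ volume) (hρ0 : 0 < ρ.real (Ioc 0 1))

include hρν hρ hρ0

theorem tendsto_betaLevel {q : ℝ} (hq : q ∈ Icc (0 : ℝ) 1) :
    Tendsto (fun n : ℕ => betaLevel ν n q) atTop (𝓝 (1 - q)) :=
  tendsto_log_div_log_of_rpow_bounds (tendsto_pow_atTop_atTop_of_one_lt one_lt_two) hρ0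
    (.of_forall fun n => le_momentSum hρν hρ n hq) (.of_forall fun n => momentSum_le ν n hq)

theorem tendsto_coe_betaLevel {q : ℝ} (hq : q ∈ Icc (0 : ℝ) 1) :
    Tendsto (fun n : ℕ => (betaLevel ν n q : EReal)) atTop (𝓝 ((1 - q : ℝ) : EReal)) :=
  (continuous_coe_real_ereal.tendsto _).comp (tendsto_betaLevel hρν hρ hρ0 hq)

theorem tendsto_fixedPoint : Tendsto (fixedPoint ν) atTop (𝓝 (1 / 2)) := by
  have hν : 0 < ν.real (Ioc 0 1) :=
    hρ0.trans_le (ENNReal.toReal_mono (measure_ne_top _ _) (hρν _))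
  have hbounds {a b : ℝ} (ha : 0 ≤ a) (ha' : a < 1 / 2) (hb : 1 / 2 < b) (hb' : b ≤ 1) :
      ∀ᶠ n in atTop, fixedPoint ν n ∈ Ioo a b := by
    filter_upwards [eventually_ne_atTop 0,
      (tendsto_pow_atTop_atTop_of_one_lt (one_lt_two (α := ℝ))).eventually_gt_atTop (ν.real univ),
      (tendsto_betaLevel hρν hρ hρ0 ⟨ha, by linarith⟩).eventually_const_lt
        (u := a) (by linarith),
      (tendsto_betaLevel hρν hρ hρ0 ⟨by linarith, hb'⟩).eventually_lt_const
        (u := b) (by linarith)] with n hn hM hna hnb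
    exact fixedPoint_mem_Ioo hν hn hM hna hnb
  refine tendsto_order.2 ⟨fun a ha => ?_, fun b hb => ?_⟩
  · refine (hbounds (le_max_right a 0) (max_lt ha one_half_pos) one_half_lt_one le_rfl).mono ?_
    exact fun n hn => (le_max_left a 0).trans_lt hn.1
  · refine (hbounds le_rfl one_half_pos (lt_min hb one_half_lt_one) (min_le_right b 1)).mono ?_
    exact fun n hn => hn.2.trans_le (min_le_left b 1)

theorem isLqRegular : IsLqRegular ν := by
  have hfix : upperFixedPoint ν = 1 / 2 := (tendsto_fixedPoint hρν hρ hρ0).limsup_eq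
  refine Or.inl ⟨1 / 2, one_half_pos, fun q hq => ?_⟩
  rw [hfix] at hq
  have hlim := tendsto_coe_betaLevel hρν hρ hρ0 (q := q) ⟨by linarith [hq.1], by linarith [hq.2]⟩
  exact hlim.limsup_eq.trans hlim.liminf_eq.symm

end LqSpectrum

/-! ### Min-max for compact symmetric operators -/

section Spectral

variable {H : Type*} [NormedAddCommGroup H] [InnerProductSpace ℝ H] {T : H →L[ℝ] H}

/-- The span of the eigenvectors of `T` with eigenvalue in `S`: the algebraic counterpart of the
range of the spectral projection of `T` onto `S`. -/
def spectralSubspace (T : H →L[ℝ] H) (S : Set ℝ) : Submodule ℝ H :=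
  ⨆ μ : S, Module.End.eigenspace (T : Module.End ℝ H) μ

theorem eigenspace_le_spectralSubspace {S : Set ℝ} {μ : ℝ} (hμ : μ ∈ S) :
    Module.End.eigenspace (T : Module.End ℝ H) μ ≤ spectralSubspace T S :=
  le_iSup (fun μ : S => Module.End.eigenspace (T : Module.End ℝ H) μ) ⟨μ, hμ⟩

theorem orthogonalFamily_eigenspaces_on (hT : (T : H →ₗ[ℝ] H).IsSymmetric) (S : Set ℝ) :
    OrthogonalFamily ℝ (fun μ : S => Module.End.eigenspace (T : Module.End ℝ H) μ)
      fun μ => (Module.End.eigenspace (T : Module.End ℝ H) μ).subtypeₗᵢ :=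
  hT.orthogonalFamily_eigenspaces.comp Subtype.val_injective

theorem exists_spectral_weights (hT : (T : H →ₗ[ℝ] H).IsSymmetric) {S : Set ℝ} {v : H}
    (hv : v ∈ spectralSubspace T S) :
    ∃ (s : Finset S) (w : S → ℝ), (∀ μ, 0 ≤ w μ) ∧ ‖v‖ ^ 2 = ∑ μ ∈ s, w μ ∧
      ⟪T v, v⟫ = ∑ μ ∈ s, (μ : ℝ) * w μ := by
  obtain ⟨f, hf, rfl⟩ := (Submodule.mem_iSup_iff_exists_finsupp _ _).1 hv
  have horth := orthogonalFamily_eigenspaces_on hT S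
  have hTf (μ : S) : T (f μ) = (μ : ℝ) • f μ := Module.End.mem_eigenspace_iff.1 (hf μ)
  refine ⟨f.support, fun μ => ‖f μ‖ ^ 2, fun μ => by positivity, ?_, ?_⟩
  · exact horth.norm_sum (fun μ => ⟨f μ, hf μ⟩) f.support
  · have h := horth.inner_sum (fun μ => (μ : ℝ) • ⟨f μ, hf μ⟩) (fun μ => ⟨f μ, hf μ⟩) f.support
    simpa [Finsupp.sum, hTf, real_inner_smul_left] using h

theorem mul_norm_sq_le_of_mem_spectralSubspace (hT : (T : H →ₗ[ℝ] H).IsSymmetric) {S : Set ℝ}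
    {c : ℝ} (hS : ∀ μ ∈ S, c ≤ μ) {v : H} (hv : v ∈ spectralSubspace T S) :
    c * ‖v‖ ^ 2 ≤ ⟪T v, v⟫ := by
  obtain ⟨s, w, hw, hnorm, hinner⟩ := exists_spectral_weights hT hv
  rw [hnorm, hinner, Finset.mul_sum]
  exact Finset.sum_le_sum fun μ _ => mul_le_mul_of_nonneg_right (hS μ μ.2) (hw μ)

theorem inner_le_of_mem_spectralSubspace (hT : (T : H →ₗ[ℝ] H).IsSymmetric) {S : Set ℝ}
    {c : ℝ} (hS : ∀ μ ∈ S, μ ≤ c) {v : H} (hv : v ∈ spectralSubspace T S) :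
    ⟪T v, v⟫ ≤ c * ‖v‖ ^ 2 := by
  obtain ⟨s, w, hw, hnorm, hinner⟩ := exists_spectral_weights hT hv
  rw [hnorm, hinner, Finset.mul_sum]
  exact Finset.sum_le_sum fun μ _ => mul_le_mul_of_nonneg_right (hS μ μ.2) (hw μ)

theorem spectralSubspace_isOrtho_compl (hT : (T : H →ₗ[ℝ] H).IsSymmetric) (S : Set ℝ) :
    spectralSubspace T S ⟂ spectralSubspace T Sᶜ := by
  simp only [spectralSubspace, Submodule.isOrtho_iSup_left, Submodule.isOrtho_iSup_right]
  rintro ⟨μ', hμ'⟩ ⟨μ, hμ⟩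
  exact hT.orthogonalFamily_eigenspaces.isOrtho (ne_of_mem_of_not_mem hμ hμ')

theorem iSup_eigenspace_le_sup_compl (S : Set ℝ) :
    ⨆ μ, Module.End.eigenspace (T : Module.End ℝ H) μ ≤
      spectralSubspace T S ⊔ spectralSubspace T Sᶜ := by
  refine iSup_le fun μ => ?_
  by_cases hμ : μ ∈ S
  · exact (eigenspace_le_spectralSubspace hμ).trans le_sup_left
  · exact (eigenspace_le_spectralSubspace (mem_compl hμ)).trans le_sup_right

theorem toENat_sum {ι : Type*} (κ : ι → Cardinal) :
    ((Cardinal.toENat (Cardinal.sum κ) : ℕ∞) : ℝ≥0∞) =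
      ∑' i, ((Cardinal.toENat (κ i) : ℕ∞) : ℝ≥0∞) := by
  have hcard (i : ι) : Cardinal.toENat (κ i) = ENat.card (κ i).out := by
    rw [ENat.card, Cardinal.mk_out]
  have hsum : Cardinal.toENat (Cardinal.sum κ) = ENat.card (Σ i, (κ i).out) := rfl
  simp only [hcard, hsum, ← ENNReal.tsum_one]
  exact ENNReal.tsum_sigma fun _ _ => 1

theorem rank_spectralSubspace (hT : (T : H →ₗ[ℝ] H).IsSymmetric) (S : Set ℝ) :
    Module.rank ℝ (spectralSubspace T S) = Cardinal.sum fun μ : S =>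
      Module.rank ℝ (Module.End.eigenspace (T : Module.End ℝ H) μ) := by
  classical
  rw [← rank_directSum]
  have hinj := (orthogonalFamily_eigenspaces_on hT S).independent.dfinsupp_lsum_injective
  have hrange := Submodule.iSup_eq_range_dfinsupp_lsum
    fun μ : S => Module.End.eigenspace (T : Module.End ℝ H) μ
  rw [spectralSubspace, hrange]
  exact rank_range_of_injective _ hinj

theorem toENat_rank_spectralSubspace_le (hT : (T : H →ₗ[ℝ] H).IsSymmetric) {F : Type*}
    [AddCommGroup F] [Module ℝ F] {c : ℝ} (Φ : H →ₗ[ℝ] F)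
    (hΦ : ∀ u, u ≠ 0 → Φ u = 0 → ⟪T u, u⟫ < c * ‖u‖ ^ 2) :
    Cardinal.toENat (Module.rank ℝ (spectralSubspace T (Ici c))) ≤
      Cardinal.toENat (Module.rank ℝ F) := by
  have hinj : Function.Injective (Φ ∘ₗ (spectralSubspace T (Ici c)).subtype) := by
    refine (injective_iff_map_eq_zero _).2 fun v hv => ?_
    by_contra hv0
    exact (hΦ v (by simpa using hv0) hv).not_ge
      (mul_norm_sq_le_of_mem_spectralSubspace hT (fun _ => id) v.2)
  simpa using Cardinal.toENat.monotone' (LinearMap.lift_rank_le_of_injective _ hinj)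

theorem inner_map_sum_smul_of_pairwise {ι : Type*} [Fintype ι] (A : H →L[ℝ] H) {u : ι → H}
    (h : Pairwise fun i j => ⟪A (u i), u j⟫ = 0) (a : ι → ℝ) :
    ⟪A (∑ i, a i • u i), ∑ i, a i • u i⟫ = ∑ i, a i ^ 2 * ⟪A (u i), u i⟫ := by
  rw [map_sum, sum_inner]
  refine Finset.sum_congr rfl fun i _ => ?_
  rw [inner_sum, Finset.sum_eq_single_of_mem i (Finset.mem_univ i) fun j _ hne => ?_, map_smul,
    real_inner_smul_left, real_inner_smul_right]
  · ring
  · rw [map_smul, real_inner_smul_left, real_inner_smul_right, h hne.symm, mul_zero, mul_zero]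

variable [CompleteSpace H]

theorem orthogonal_spectralSubspace_le_topologicalClosure (hT : (T : H →ₗ[ℝ] H).IsSymmetric)
    (hcomp : IsCompactOperator T) (S : Set ℝ) :
    (spectralSubspace T S)ᗮ ≤ (spectralSubspace T Sᶜ).topologicalClosure := by
  set V := spectralSubspace T S
  set W := spectralSubspace T Sᶜ
  have hdense : Vᗮ ⊓ Wᗮ = ⊥ := by
    rw [Submodule.inf_orthogonal, eq_bot_iff,
      ← ContinuousLinearMap.orthogonalComplement_iSup_eigenspaces_eq_bot hcomp hT]
    exact Submodule.orthogonal_le (iSup_eigenspace_le_sup_compl S)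
  have hWV : W.topologicalClosure ≤ Vᗮ :=
    W.topologicalClosure_minimal (spectralSubspace_isOrtho_compl hT S).symm
      (Submodule.isClosed_orthogonal V)
  have hsup := Submodule.sup_orthogonal_inf_of_hasOrthogonalProjection hWV
  rw [Submodule.orthogonal_closure, inf_comm, hdense, sup_bot_eq] at hsup
  exact hsup.ge

theorem inner_le_of_mem_orthogonal_spectralSubspace (hT : (T : H →ₗ[ℝ] H).IsSymmetric)
    (hcomp : IsCompactOperator T) {c : ℝ} {u : H} (hu : u ∈ (spectralSubspace T (Ici c))ᗮ) :
    ⟪T u, u⟫ ≤ c * ‖u‖ ^ 2 := by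
  have hclosed : IsClosed {v : H | ⟪T v, v⟫ ≤ c * ‖v‖ ^ 2} :=
    isClosed_le (by fun_prop) (by fun_prop)
  exact closure_minimal
    (fun v hv => inner_le_of_mem_spectralSubspace hT (fun μ hμ => (not_le.1 hμ).le) hv) hclosed
    (orthogonal_spectralSubspace_le_topologicalClosure hT hcomp _ hu)

theorem le_toENat_rank_spectralSubspace (hT : (T : H →ₗ[ℝ] H).IsSymmetric)
    (hcomp : IsCompactOperator T) {F : Type*} [AddCommGroup F] [Module ℝ F] {c : ℝ}
    (Ψ : F →ₗ[ℝ] H) (hΨ : ∀ a, a ≠ 0 → c * ‖Ψ a‖ ^ 2 < ⟪T (Ψ a), Ψ a⟫) :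
    Cardinal.toENat (Module.rank ℝ F) ≤
      Cardinal.toENat (Module.rank ℝ (spectralSubspace T (Ici c))) := by
  set V := spectralSubspace T (Ici c)
  by_cases hfin : FiniteDimensional ℝ V
  · have hinj : Function.Injective ((V.orthogonalProjectionOnto : H →ₗ[ℝ] V) ∘ₗ Ψ) := by
      refine (injective_iff_map_eq_zero _).2 fun a ha => ?_
      by_contra ha0
      have horth : Ψ a ∈ Vᗮ := by
        rw [← V.ker_orthogonalProjectionOnto]
        exact ha
      exact (hΨ a ha0).not_ge (inner_le_of_mem_orthogonal_spectralSubspace hT hcomp horth)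
    simpa using Cardinal.toENat.monotone' (LinearMap.lift_rank_le_of_injective _ hinj)
  · have htop : Cardinal.toENat (Module.rank ℝ V) = ⊤ :=
      Cardinal.toENat_eq_top.2 (not_lt.1 fun h => hfin (Module.rank_lt_aleph0_iff.1 h))
    exact htop ▸ le_top

theorem card_le_toENat_rank_spectralSubspace (hT : (T : H →ₗ[ℝ] H).IsSymmetric)
    (hcomp : IsCompactOperator T) {ι : Type*} [Fintype ι] {u : ι → H} {c : ℝ}
    (horth : Pairwise fun i j => ⟪u i, u j⟫ = 0) (horth' : Pairwise fun i j => ⟪T (u i), u j⟫ = 0)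
    (hu : ∀ i, c * ‖u i‖ ^ 2 < ⟪T (u i), u i⟫) :
    Fintype.card ι ≤ Cardinal.toENat (Module.rank ℝ (spectralSubspace T (Ici c))) := by
  have h := le_toENat_rank_spectralSubspace hT hcomp (Fintype.linearCombination ℝ u) (c := c) ?_
  · simpa using h
  intro a ha
  obtain ⟨i, hi⟩ := Function.ne_iff.1 ha
  have hnorm : ‖∑ i, a i • u i‖ ^ 2 = ∑ i, a i ^ 2 * ‖u i‖ ^ 2 := by
    simpa using inner_map_sum_smul_of_pairwise (.id ℝ H) horth a
  rw [Fintype.linearCombination_apply, hnorm, inner_map_sum_smul_of_pairwise T horth',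
    Finset.mul_sum]
  simp only [mul_left_comm c]
  exact Finset.sum_lt_sum (fun j _ => by gcongr; exact (hu j).le)
    ⟨i, Finset.mem_univ i, mul_lt_mul_of_pos_left (hu i) (sq_pos_iff.2 hi)⟩

end Spectral

/-! ### Functions in `H¹₀(0,1)` and their derivatives -/

/-- The Hilbert space `L²([0,1], Λ)` of candidate weak derivatives. -/
abbrev L2 : Type := Lp ℝ 2 ((volume : Measure ℝ).restrict (Icc 0 1))

/-- The indicator function of `[0,y]` in `L²([0,1])`, which represents integration over `[0,y]`. -/
noncomputable def ind (y : ℝ) : L2 :=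
  indicatorConstLp 2 (measurableSet_Icc (a := 0) (b := y))
    (measure_ne_top (volume.restrict (Icc (0 : ℝ) 1)) _) (1 : ℝ)

/-- The derivative `t ↦ 1_{[0,y]}(t) - y` of the Green function of the Dirichlet problem on `[0,1]`
with pole `y`; it represents evaluation at `y` on the derivatives of functions in `H¹₀`. -/
noncomputable def kern (y : ℝ) : L2 := ind y - y • ind 1

/-- The derivatives of functions in `H¹₀(0,1)`: the elements of `L²([0,1])` with mean zero. -/
noncomputable def meanZero : Submodule ℝ L2 := (ℝ ∙ ind 1)ᗮ

theorem mem_meanZero {u : L2} : u ∈ meanZero ↔ ⟪ind 1, u⟫ = 0 :=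
  Submodule.mem_orthogonal_singleton_iff_inner_right

theorem integrableOn_coeFn (u : L2) : IntegrableOn u (Icc 0 1) :=
  (Lp.memLp u).integrable one_le_two

theorem inner_ind {y : ℝ} (hy : y ≤ 1) (u : L2) : ⟪ind y, u⟫ = ∫ t in Icc 0 y, u t := by
  rw [ind, MeasureTheory.L2.inner_indicatorConstLp_one, Measure.restrict_restrict measurableSet_Icc,
    Icc_inter_Icc, max_self, min_eq_left hy]

theorem inner_ind_ind {x y : ℝ} (hx : x ∈ Icc (0 : ℝ) 1) (hy : y ∈ Icc (0 : ℝ) 1) :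
    ⟪ind x, ind y⟫ = min x y := by
  rw [ind, ind, MeasureTheory.L2.real_inner_indicatorConstLp_one_indicatorConstLp_one,
    measureReal_restrict_apply (measurableSet_Icc.inter measurableSet_Icc), Icc_inter_Icc,
    Icc_inter_Icc, Real.volume_real_Icc_of_le] <;>
  simp [hx.1, hx.2, hy.1, hy.2]

theorem inner_ind_kern {x y : ℝ} (hx : x ∈ Icc (0 : ℝ) 1) (hy : y ∈ Icc (0 : ℝ) 1) :
    ⟪ind x, kern y⟫ = min x y - x * y := by
  rw [kern, inner_sub_right, real_inner_smul_right, inner_ind_ind hx hy,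
    inner_ind_ind hx (right_mem_Icc.2 zero_le_one), min_eq_left hx.2, mul_comm]

theorem kern_mem_meanZero {y : ℝ} (hy : y ∈ Icc (0 : ℝ) 1) : kern y ∈ meanZero := by
  rw [mem_meanZero, inner_ind_kern (right_mem_Icc.2 zero_le_one) hy, min_eq_right hy.2, one_mul,
    sub_self]

theorem inner_kern_eq_inner_ind {u : L2} (hu : u ∈ meanZero) (y : ℝ) :
    ⟪kern y, u⟫ = ⟪ind y, u⟫ := by
  rw [kern, inner_sub_left, real_inner_smul_left, mem_meanZero.1 hu, mul_zero, sub_zero]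

theorem inner_kern_kern {x y : ℝ} (hx : x ∈ Icc (0 : ℝ) 1) (hy : y ∈ Icc (0 : ℝ) 1) :
    ⟪kern x, kern y⟫ = min x y - x * y := by
  rw [inner_kern_eq_inner_ind (kern_mem_meanZero hy), inner_ind_kern hx hy]

theorem kern_zero : kern 0 = 0 := by
  have h0 : (0 : ℝ) ∈ Icc (0 : ℝ) 1 := left_mem_Icc.2 zero_le_one
  simpa using inner_kern_kern h0 h0

theorem kern_one : kern 1 = 0 := by simp [kern]

theorem continuous_ind : Continuous ind := by
  refine continuous_indicatorConstLp_set (by simp) fun x => ?_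
  have hb (y : ℝ) :
      volume.restrict (Icc 0 1) (symmDiff (Icc 0 y) (Icc 0 x)) ≤ ENNReal.ofReal |y - x| := by
    refine (Measure.restrict_apply_le _ _).trans ?_
    refine (measure_mono (t := uIcc x y) ?_).trans_eq Real.volume_interval
    rintro z (⟨⟨h0, hz⟩, hz'⟩ | ⟨⟨h0, hz⟩, hz'⟩) <;>
      simp only [mem_Icc, h0, true_and, not_le] at hz'
    · exact mem_uIcc.2 (Or.inl ⟨hz'.le, hz⟩)
    · exact mem_uIcc.2 (Or.inr ⟨hz'.le, hz⟩)
  refine tendsto_of_tendsto_of_tendsto_of_le_of_le tendsto_const_nhds ?_ (fun _ => zero_le) hb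
  have : Continuous fun y : ℝ => ENNReal.ofReal |y - x| :=
    ENNReal.continuous_ofReal.comp (by fun_prop)
  simpa using this.tendsto x

@[fun_prop]
theorem continuous_kern : Continuous kern :=
  continuous_ind.sub (continuous_id.smul continuous_const)

/-- The function on `[0,1]`, extended by zero, that vanishes at the endpoints and whose derivative
is `u` minus its mean. -/
noncomputable def primitive : L2 →ₗ[ℝ] (ℝ → ℝ) where
  toFun u := (Icc (0 : ℝ) 1).indicator fun y => ⟪kern y, u⟫
  map_add' u v := by ext y; by_cases hy : y ∈ Icc (0 : ℝ) 1 <;> simp [hy, inner_add_right]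
  map_smul' a u := by ext y; by_cases hy : y ∈ Icc (0 : ℝ) 1 <;> simp [hy, real_inner_smul_right]

theorem primitive_apply {y : ℝ} (hy : y ∈ Icc (0 : ℝ) 1) (u : L2) :
    primitive u y = ⟪kern y, u⟫ :=
  indicator_of_mem (f := fun y => ⟪kern y, u⟫) hy

theorem primitive_apply_of_notMem {y : ℝ} (hy : y ∉ Ioo (0 : ℝ) 1) (u : L2) :
    primitive u y = 0 := by
  by_cases h : y ∈ Icc (0 : ℝ) 1
  · rcases eq_endpoints_or_mem_Ioo_of_mem_Icc h with rfl | rfl | h'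
    · rw [primitive_apply h, kern_zero, inner_zero_left]
    · rw [primitive_apply h, kern_one, inner_zero_left]
    · exact absurd h' hy
  · exact indicator_of_notMem (f := fun y => ⟪kern y, u⟫) h

theorem primitive_eq_inner_ind {u : L2} (hu : u ∈ meanZero) {x : ℝ} (hx : x ∈ Icc (0 : ℝ) 1) :
    primitive u x = ⟪ind x, u⟫ := by
  rw [primitive_apply hx, inner_kern_eq_inner_ind hu]

theorem isWeakDeriv_primitive {u : L2} (hu : u ∈ meanZero) : IsWeakDeriv (primitive u) u := by
  refine ⟨Lp.memLp u, fun x hx => ?_⟩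
  rw [primitive_eq_inner_ind hu hx, inner_ind hx.2, primitive_apply_of_notMem (by simp), zero_add]

theorem primitive_mem_H10 {u : L2} (hu : u ∈ meanZero) : primitive u ∈ H10 :=
  ⟨⟨u, isWeakDeriv_primitive hu⟩, fun _ hx => primitive_apply_of_notMem hx u⟩

theorem eq_zero_of_forall_inner_ind {u : L2} (h : ∀ x ∈ Ioo (0 : ℝ) 1, ⟪ind x, u⟫ = 0) :
    u = 0 := by
  have hint : IntervalIntegrable u volume 0 1 :=
    (intervalIntegrable_iff_integrableOn_Icc_of_le zero_le_one).2 (integrableOn_coeFn u)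
  have hzero {x : ℝ} (hx : x ∈ Ioo (0 : ℝ) 1) : ∫ t in (0 : ℝ)..x, u t = 0 := by
    rw [intervalIntegral.integral_of_le hx.1.le, ← integral_Icc_eq_integral_Ioc,
      ← inner_ind hx.2.le, h x hx]
  refine Lp.eq_zero_iff_ae_eq_zero.2 ?_
  suffices hae : ∀ᵐ x ∂volume.restrict (Ioo 0 1), u x = 0 by
    rwa [restrict_Ioo_eq_restrict_Icc] at hae
  refine (ae_restrict_iff' measurableSet_Ioo).2 ?_
  filter_upwards [hint.ae_hasDerivAt_integral] with x hderiv hx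
  rw [uIcc_of_le zero_le_one] at hderiv
  have hx' := Ioo_subset_Icc_self hx
  have hev : (fun y => ∫ t in (0 : ℝ)..y, u t) =ᶠ[𝓝 x] fun _ => 0 := by
    filter_upwards [isOpen_Ioo.mem_nhds hx] with y hy using hzero hy
  exact (hderiv hx' 0 (left_mem_Icc.2 zero_le_one)).unique
    ((hasDerivAt_const x (0 : ℝ)).congr_of_eventuallyEq hev)

theorem primitive_injOn : InjOn primitive meanZero := by
  intro u hu v hv huv
  refine sub_eq_zero.1 (eq_zero_of_forall_inner_ind fun x hx => ?_)
  have hx' := Ioo_subset_Icc_self hx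
  rw [inner_sub_right, ← primitive_eq_inner_ind hu hx', ← primitive_eq_inner_ind hv hx', huv,
    sub_self]

theorem inner_ind_toLp {g : ℝ → ℝ} (hg : MemLp g 2 (volume.restrict (Icc 0 1))) {x : ℝ}
    (hx : x ≤ 1) : ⟪ind x, hg.toLp g⟫ = ∫ t in Icc 0 x, g t := by
  rw [inner_ind hx]
  exact integral_congr_ae (ae_restrict_of_ae_restrict_of_subset (Icc_subset_Icc_right hx)
    hg.coeFn_toLp)

theorem inner_ind_toLp_of_isWeakDeriv {f g : ℝ → ℝ} (h : IsWeakDeriv f g) {x : ℝ}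
    (hx : x ∈ Icc (0 : ℝ) 1) : ⟪ind x, h.1.toLp g⟫ = f x - f 0 := by
  rw [inner_ind_toLp h.1 hx.2, h.2 x hx, add_sub_cancel_left]

theorem IsWeakDeriv.ae_eq {f g₁ g₂ : ℝ → ℝ} (h₁ : IsWeakDeriv f g₁) (h₂ : IsWeakDeriv f g₂) :
    g₁ =ᵐ[volume.restrict (Icc 0 1)] g₂ := by
  refine (MemLp.toLp_eq_toLp_iff h₁.1 h₂.1).1 (sub_eq_zero.1 ?_)
  refine eq_zero_of_forall_inner_ind fun x hx => ?_
  have hx' := Ioo_subset_Icc_self hx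
  rw [inner_sub_right, inner_ind_toLp_of_isWeakDeriv h₁ hx', inner_ind_toLp_of_isWeakDeriv h₂ hx',
    sub_self]

theorem weakDeriv_ae_eq {f g : ℝ → ℝ} (h : IsWeakDeriv f g) :
    weakDeriv f =ᵐ[volume.restrict (Icc 0 1)] g := by
  have hex : ∃ g, IsWeakDeriv f g := ⟨g, h⟩
  rw [weakDeriv, dif_pos hex]
  exact hex.choose_spec.ae_eq h

theorem exists_primitive_eq {f : ℝ → ℝ} (hf : f ∈ H10) : ∃ u ∈ meanZero, primitive u = f := by
  obtain ⟨⟨g, hg⟩, hzero⟩ := hf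
  have hind {x : ℝ} (hx : x ∈ Icc (0 : ℝ) 1) : ⟪ind x, hg.1.toLp g⟫ = f x := by
    rw [inner_ind_toLp_of_isWeakDeriv hg hx, hzero 0 (by simp), sub_zero]
  have hmean : hg.1.toLp g ∈ meanZero := by
    rw [mem_meanZero, hind (right_mem_Icc.2 zero_le_one), hzero 1 (by simp)]
  refine ⟨_, hmean, funext fun x => ?_⟩
  by_cases hx : x ∈ Ioo (0 : ℝ) 1
  · have hx' := Ioo_subset_Icc_self hx
    rw [primitive_eq_inner_ind hmean hx', hind hx']
  · rw [hzero x hx, primitive_apply_of_notMem hx]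

theorem energy_primitive {u v : L2} (hu : u ∈ meanZero) (hv : v ∈ meanZero) :
    energy (primitive u) (primitive v) = ⟪u, v⟫ := by
  rw [energy, restrict_Ioo_eq_restrict_Icc, MeasureTheory.L2.inner_def]
  refine integral_congr_ae ?_
  filter_upwards [weakDeriv_ae_eq (isWeakDeriv_primitive hu),
    weakDeriv_ae_eq (isWeakDeriv_primitive hv)] with x h1 h2
  rw [h1, h2, RCLike.inner_apply, conj_trivial, mul_comm]

/-! ### The Green operator -/

/-- The rank one operator `u ↦ ⟪kern y, u⟫ kern y`. -/
noncomputable def rankOneKern (y : ℝ) : L2 →L[ℝ] L2 :=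
  (innerSL ℝ (kern y)).smulRight (kern y)

theorem rankOneKern_apply (y : ℝ) (u : L2) : rankOneKern y u = ⟪kern y, u⟫ • kern y := rfl

theorem continuous_rankOneKern : Continuous rankOneKern :=
  (ContinuousLinearMap.smulRightL ℝ L2 L2).continuous₂.comp
    (((innerSL ℝ).continuous.comp continuous_kern).prodMk continuous_kern)

theorem isCompactOperator_rankOneKern (y : ℝ) : IsCompactOperator (rankOneKern y) := by
  have hfactor : rankOneKern y =
      ContinuousLinearMap.toSpanSingleton ℝ (kern y) ∘L innerSL ℝ (kern y) := by
    ext1 u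
    simp [rankOneKern_apply]
  have hcompact : IsCompactOperator (innerSL ℝ (kern y)) :=
    isCompactOperator_of_locallyCompactSpace_dom _
  rw [hfactor]
  exact hcompact.clm_comp (ContinuousLinearMap.toSpanSingleton ℝ (kern y))

/-- The Green operator of the Kreĭn–Feller operator of `ν`, acting on derivatives: the operator on
`L²([0,1])` that represents the form `∫ f g dν`. -/
noncomputable def green (ν : Measure ℝ) : L2 →L[ℝ] L2 := ∫ y, rankOneKern y ∂ν

/-- The derivatives of the functions in the Dirichlet domain of `ν`. -/
noncomputable def formDerivs (ν : Measure ℝ) : Submodule ℝ L2 where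
  carrier := {u | u ∈ meanZero ∧ AffineOffSupport ν (primitive u)}
  add_mem' := by
    rintro u v ⟨hu, hu'⟩ ⟨hv, hv'⟩
    refine ⟨add_mem hu hv, fun x hx => ?_⟩
    obtain ⟨m, c, h⟩ := hu' x hx
    obtain ⟨m', c', h'⟩ := hv' x hx
    exact ⟨m + m', c + c', fun y hy => by rw [map_add, Pi.add_apply, h y hy, h' y hy]; ring⟩
  zero_mem' := ⟨zero_mem _, fun _ _ => ⟨0, 0, by simp⟩⟩
  smul_mem' := by
    rintro a u ⟨hu, hu'⟩
    refine ⟨Submodule.smul_mem _ a hu, fun x hx => ?_⟩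
    obtain ⟨m, c, h⟩ := hu' x hx
    exact ⟨a * m, a * c, fun y hy => by rw [map_smul, Pi.smul_apply, h y hy, smul_eq_mul]; ring⟩

theorem formDomain_eq_image (ν : Measure ℝ) : formDomain ν = primitive '' formDerivs ν := by
  ext f
  constructor
  · rintro ⟨hf, haff⟩
    obtain ⟨u, hu, rfl⟩ := exists_primitive_eq hf
    exact ⟨u, ⟨hu, haff⟩, rfl⟩
  · rintro ⟨u, ⟨hu, haff⟩, rfl⟩
    exact ⟨primitive_mem_H10 hu, haff⟩

theorem min_eq_ite_of_notMem {C : Set ℝ} (hC : C.OrdConnected) {x₀ x y : ℝ} (hx₀ : x₀ ∈ C)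
    (hx : x ∈ C) (hy : y ∉ C) : min y x = if y < x₀ then y else x := by
  split_ifs with hlt
  · exact min_eq_left (le_of_not_ge fun h => hy (hC.out hx hx₀ ⟨h, hlt.le⟩))
  · exact min_eq_right (le_of_not_ge fun h => hy (hC.out hx₀ hx ⟨not_lt.1 hlt, h⟩))

section Green

variable {ν : Measure ℝ}

theorem ae_mem_Icc (hν : ν (Ioo 0 1)ᶜ = 0) : ∀ᵐ y ∂ν, y ∈ Icc (0 : ℝ) 1 := by
  filter_upwards [measure_eq_zero_iff_ae_notMem.1 hν] with y hy
  exact Ioo_subset_Icc_self (not_not.1 hy)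

theorem mem_eigenspace_green_inv {l : ℝ} (hl : l ≠ 0) {u : L2} :
    u ∈ Module.End.eigenspace (green ν : L2 →ₗ[ℝ] L2) l⁻¹ ↔ u = l • green ν u := by
  rw [Module.End.mem_eigenspace_iff, ContinuousLinearMap.coe_coe, eq_inv_smul_iff₀ hl, eq_comm]

variable [IsFiniteMeasure ν]

theorem integrable_of_continuous {E : Type*} [NormedAddCommGroup E] {f : ℝ → E}
    (hν : ν (Ioo 0 1)ᶜ = 0) (hf : Continuous f) : Integrable f ν := by
  rw [← Measure.restrict_eq_self_of_ae_mem (ae_mem_Icc hν)]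
  exact hf.continuousOn.integrableOn_compact isCompact_Icc

theorem isCompactOperator_green (hν : ν (Ioo 0 1)ᶜ = 0) : IsCompactOperator (green ν) := by
  rcases eq_or_ne ν 0 with rfl | hne
  · rw [green, integral_zero_measure]
    exact isCompactOperator_zero
  have := NeZero.mk hne
  let S : Submodule ℝ (L2 →L[ℝ] L2) := compactOperator (RingHom.id ℝ) L2 L2
  have haverage : ⨍ y, rankOneKern y ∂ν ∈ S :=
    S.convex.average_mem isClosed_setOfPred_isCompactOperator
      (Eventually.of_forall isCompactOperator_rankOneKern)
      (integrable_of_continuous hν continuous_rankOneKern)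
  rw [green, ← measure_smul_average]
  exact S.smul_mem _ haverage

theorem inner_green (hν : ν (Ioo 0 1)ᶜ = 0) (u v : L2) :
    ⟪green ν u, v⟫ = ∫ y, ⟪kern y, u⟫ * ⟪kern y, v⟫ ∂ν := by
  have hint := integrable_of_continuous hν continuous_rankOneKern
  rw [green, ContinuousLinearMap.integral_apply hint, real_inner_comm,
    ← integral_inner (hint.apply_continuousLinearMap u)]
  simp only [rankOneKern_apply, real_inner_smul_right, real_inner_comm]

theorem isSymmetric_green (hν : ν (Ioo 0 1)ᶜ = 0) : (green ν : L2 →ₗ[ℝ] L2).IsSymmetric := by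
  intro u v
  rw [ContinuousLinearMap.coe_coe, real_inner_comm _ u, inner_green hν, inner_green hν]
  simp only [mul_comm]

theorem inner_green_self_nonneg (hν : ν (Ioo 0 1)ᶜ = 0) (u : L2) : 0 ≤ ⟪green ν u, u⟫ := by
  rw [inner_green hν]
  exact integral_nonneg fun y => mul_self_nonneg _

theorem integral_primitive_mul (hν : ν (Ioo 0 1)ᶜ = 0) (u v : L2) :
    ∫ y, primitive u y * primitive v y ∂ν = ⟪green ν u, v⟫ := by
  rw [inner_green hν]
  refine integral_congr_ae ?_
  filter_upwards [ae_mem_Icc hν] with y hy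
  rw [primitive_apply hy, primitive_apply hy]

theorem green_mem_meanZero (hν : ν (Ioo 0 1)ᶜ = 0) (u : L2) : green ν u ∈ meanZero := by
  rw [mem_meanZero, real_inner_comm, inner_green hν]
  refine integral_eq_zero_of_ae ?_
  filter_upwards [ae_mem_Icc hν] with y hy
  rw [real_inner_comm (ind 1), mem_meanZero.1 (kern_mem_meanZero hy), mul_zero, Pi.zero_apply]

-- On a component `C` of the complement of the support, `min y x` is affine in `x ∈ C` for each
-- `y` in the support, hence so is `G u x = ∫ (min y x - y x) ⟪kern y, u⟫ dν(y)`.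
theorem affineOffSupport_primitive_green (hν : ν (Ioo 0 1)ᶜ = 0) (u : L2) :
    AffineOffSupport ν (primitive (green ν u)) := by
  intro x₀ hx₀
  set C := connectedComponentIn (Icc (0 : ℝ) 1 \ ν.support) x₀
  have hCsub : C ⊆ Icc 0 1 \ ν.support := connectedComponentIn_subset _ _
  have hC : C.OrdConnected := isPreconnected_connectedComponentIn.ordConnected
  have hx₀C : x₀ ∈ C := mem_connectedComponentIn hx₀
  let φ : ℝ → ℝ := fun y => ⟪kern y, u⟫
  have hφ : Integrable φ ν := integrable_of_continuous hν (by fun_prop)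
  have hyφ : Integrable (fun y => y * φ y) ν := integrable_of_continuous hν (by fun_prop)
  have hslope : Integrable (fun y => (Iio x₀)ᶜ.indicator φ y - y * φ y) ν :=
    (hφ.indicator measurableSet_Iio.compl).sub hyφ
  refine ⟨∫ y, (Iio x₀)ᶜ.indicator φ y - y * φ y ∂ν,
    ∫ y, (Iio x₀).indicator (fun y => y * φ y) y ∂ν, fun x hx => ?_⟩
  have hx01 := (hCsub hx).1
  rw [primitive_apply hx01, real_inner_comm, inner_green hν, ← integral_mul_const,
    ← integral_add (hslope.mul_const x) (hyφ.indicator measurableSet_Iio)]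
  refine integral_congr_ae ?_
  filter_upwards [ae_mem_Icc hν, Measure.support_mem_ae (μ := ν)] with y hy hysupp
  rw [inner_kern_kern hy hx01, min_eq_ite_of_notMem hC hx₀C hx fun h => (hCsub h).2 hysupp]
  by_cases hlt : y < x₀ <;> simp [hlt, φ, -compl_Iio] <;> ring

theorem green_mem_formDerivs (hν : ν (Ioo 0 1)ᶜ = 0) (u : L2) : green ν u ∈ formDerivs ν :=
  ⟨green_mem_meanZero hν u, affineOffSupport_primitive_green hν u⟩

theorem isEigenfunction_iff (hν : ν (Ioo 0 1)ᶜ = 0) {l : ℝ} {f : ℝ → ℝ} :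
    IsEigenfunction ν l f ↔ ∃ u, u ≠ 0 ∧ u = l • green ν u ∧ primitive u = f := by
  rw [IsEigenfunction, formDomain_eq_image]
  constructor
  · rintro ⟨⟨u, hu, rfl⟩, hne, heigen⟩
    refine ⟨u, fun h => hne (by rw [h, map_zero]), sub_eq_zero.1 ?_, rfl⟩
    have hmem : u - l • green ν u ∈ formDerivs ν :=
      sub_mem hu (Submodule.smul_mem _ l (green_mem_formDerivs hν u))
    rw [← inner_self_eq_zero (𝕜 := ℝ), inner_sub_left, real_inner_smul_left,
      ← integral_primitive_mul hν, ← heigen _ ⟨_, hmem, rfl⟩, energy_primitive hu.1 hmem.1,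
      sub_self]
  · rintro ⟨u, hne, heigen, rfl⟩
    have hu : u ∈ formDerivs ν :=
      heigen ▸ Submodule.smul_mem _ l (green_mem_formDerivs hν u)
    refine ⟨⟨u, hu, rfl⟩, fun h => hne ?_, ?_⟩
    · exact primitive_injOn hu.1 (zero_mem meanZero) (by rw [h, map_zero])
    · rintro _ ⟨v, hv, rfl⟩
      rw [energy_primitive hu.1 hv.1, integral_primitive_mul hν, ← real_inner_smul_left, ← heigen]

theorem multiplicity_eq_zero (hν : ν (Ioo 0 1)ᶜ = 0) {l : ℝ} (hl : l ≤ 0) :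
    multiplicity ν l = 0 := by
  have hempty : {f | IsEigenfunction ν l f} = ∅ := by
    refine eq_empty_of_forall_notMem fun f hf => ?_
    obtain ⟨u, hne, heigen, -⟩ := (isEigenfunction_iff hν).1 hf
    have h : ⟪u, u⟫ = l * ⟪green ν u, u⟫ := by rw [← real_inner_smul_left, ← heigen]
    exact (real_inner_self_pos.2 hne).not_ge
      (h.trans_le (mul_nonpos_of_nonpos_of_nonneg hl (inner_green_self_nonneg hν u)))
  rw [multiplicity, hempty, Submodule.span_empty, rank_bot, map_zero]

theorem span_isEigenfunction (hν : ν (Ioo 0 1)ᶜ = 0) {l : ℝ} (hl : l ≠ 0) :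
    Submodule.span ℝ {f | IsEigenfunction ν l f} =
      (Module.End.eigenspace (green ν : L2 →ₗ[ℝ] L2) l⁻¹).map primitive := by
  refine le_antisymm (Submodule.span_le.2 fun f hf => ?_) ?_
  · obtain ⟨u, -, heigen, rfl⟩ := (isEigenfunction_iff hν).1 hf
    exact Submodule.mem_map_of_mem ((mem_eigenspace_green_inv hl).2 heigen)
  · rintro _ ⟨u, hu, rfl⟩
    by_cases hne : u = 0
    · rw [hne, map_zero]
      exact zero_mem _
    · exact Submodule.subset_span
        ((isEigenfunction_iff hν).2 ⟨u, hne, (mem_eigenspace_green_inv hl).1 hu, rfl⟩)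

theorem multiplicity_eq (hν : ν (Ioo 0 1)ᶜ = 0) {l : ℝ} (hl : l ≠ 0) :
    multiplicity ν l =
      Cardinal.toENat (Module.rank ℝ (Module.End.eigenspace (green ν : L2 →ₗ[ℝ] L2) l⁻¹)) := by
  set E := Module.End.eigenspace (green ν : L2 →ₗ[ℝ] L2) l⁻¹
  have hE : ∀ u ∈ E, u ∈ meanZero := fun u hu =>
    (mem_eigenspace_green_inv hl).1 hu ▸ Submodule.smul_mem _ l (green_mem_meanZero hν u)
  have hinj : Function.Injective (primitive.domRestrict E) := fun u v huv =>
    Subtype.ext (primitive_injOn (hE u u.2) (hE v v.2) huv)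
  rw [multiplicity, span_isEigenfunction hν hl, ← LinearMap.range_domRestrict,
    rank_range_of_injective _ hinj]

theorem eigenvalueCount_eq (hν : ν (Ioo 0 1)ᶜ = 0) {x : ℝ} (hx : 0 < x) :
    eigenvalueCount ν x = ((Cardinal.toENat
      (Module.rank ℝ (spectralSubspace (green ν) (Ici x⁻¹))) : ℕ∞) : ℝ≥0∞) := by
  rw [eigenvalueCount, rank_spectralSubspace (isSymmetric_green hν), toENat_sum,
    tsum_subtype (Iic x) fun l => ((multiplicity ν l : ℕ∞) : ℝ≥0∞),
    tsum_subtype (Ici x⁻¹) fun μ => ((Cardinal.toENat (Module.rank ℝ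
      (Module.End.eigenspace (green ν : L2 →ₗ[ℝ] L2) μ)) : ℕ∞) : ℝ≥0∞),
    ← (Equiv.inv ℝ).tsum_eq]
  refine tsum_congr fun μ => ?_
  rcases le_or_gt μ 0 with hμ | hμ
  · have hμx : μ ∉ Ici x⁻¹ := fun h => (hμ.trans_lt (inv_pos.2 hx)).not_ge h
    have hmult := multiplicity_eq_zero hν (inv_nonpos.2 hμ)
    rw [indicator_of_notMem hμx]
    exact indicator_apply_eq_zero.2 fun _ => by simp [hmult]
  · have hmem : μ⁻¹ ∈ Iic x ↔ μ ∈ Ici x⁻¹ := inv_le_comm₀ hμ hx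
    by_cases h : μ ∈ Ici x⁻¹
    · rw [Equiv.inv_apply, indicator_of_mem h, indicator_of_mem (hmem.2 h),
        multiplicity_eq hν (inv_ne_zero hμ.ne'), inv_inv]
    · rw [Equiv.inv_apply, indicator_of_notMem h, indicator_of_notMem (mt hmem.1 h)]

end Green

/-! ### The upper bound on the eigenvalue count -/

section Quantile

/-- The point of `[0,1]` at which the distribution function of `ρ` reaches the level `a`, or
`1` if the level is not reached before. -/
noncomputable def quantile (ρ : Measure ℝ) (a : ℝ) : ℝ :=
  sInf (insert 1 {t ∈ Icc 0 1 | a ≤ ρ.real (Iic t)})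

variable {ρ : Measure ℝ}

theorem quantile_mem_Icc (ρ : Measure ℝ) (a : ℝ) : quantile ρ a ∈ Icc (0 : ℝ) 1 := by
  have hlower : 0 ∈ lowerBounds (insert 1 {t ∈ Icc (0 : ℝ) 1 | a ≤ ρ.real (Iic t)}) := by
    rintro t (rfl | ht)
    exacts [zero_le_one, ht.1.1]
  exact ⟨le_csInf (insert_nonempty _ _) hlower, csInf_le ⟨0, hlower⟩ (mem_insert _ _)⟩

theorem quantile_le {a t : ℝ} (ht : 0 ≤ t) (ha : a ≤ ρ.real (Iic t)) : quantile ρ a ≤ t := by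
  rcases le_total t 1 with h | h
  · refine csInf_le ⟨0, ?_⟩ (mem_insert_of_mem _ ⟨⟨ht, h⟩, ha⟩)
    rintro s (rfl | hs)
    exacts [zero_le_one, hs.1.1]
  · exact (quantile_mem_Icc ρ a).2.trans h

theorem quantile_zero (ρ : Measure ℝ) : quantile ρ 0 = 0 :=
  (quantile_le le_rfl measureReal_nonneg).antisymm (quantile_mem_Icc ρ 0).1

variable [IsFiniteMeasure ρ]

theorem le_real_Iic_of_quantile_lt {a s : ℝ} (hs : s ≤ 1) (h : quantile ρ a < s) :
    a ≤ ρ.real (Iic s) := by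
  obtain ⟨t, rfl | ht, hts⟩ := exists_lt_of_csInf_lt (insert_nonempty _ _) h
  · exact absurd hts hs.not_gt
  · exact ht.2.trans (measureReal_mono (Iic_subset_Iic.2 hts.le))

theorem quantile_eq_one {a : ℝ} (ha : ρ.real univ < a) : quantile ρ a = 1 := by
  refine (quantile_mem_Icc ρ a).2.eq_of_not_lt fun h => ha.not_ge ?_
  exact (le_real_Iic_of_quantile_lt le_rfl h).trans (measureReal_mono (subset_univ _))

theorem quantile_mono : Monotone (quantile ρ) := by
  intro a b hab
  refine le_of_forall_gt_imp_ge_of_dense fun s hs => ?_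
  rcases le_or_gt s 1 with h | h
  · exact quantile_le ((quantile_mem_Icc ρ b).1.trans hs.le)
      (hab.trans (le_real_Iic_of_quantile_lt h hs))
  · exact (quantile_mem_Icc ρ a).2.trans h.le

theorem real_Ioo_le_of_forall_real_Ioc_le {a b c : ℝ} (hc : 0 ≤ c)
    (h : ∀ s s', a < s → s < s' → s' < b → ρ.real (Ioc s s') ≤ c) : ρ.real (Ioo a b) ≤ c := by
  by_contra! hlt
  obtain ⟨K, hKsub, hK, hcK⟩ := isOpen_Ioo.exists_lt_isCompact
    ((ENNReal.ofReal_lt_iff_lt_toReal hc (measure_ne_top ρ _)).2 hlt)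
  have hne : K.Nonempty := by
    by_contra! hK0
    simp [hK0] at hcK
  have hinf := hKsub (hK.sInf_mem hne)
  have hsup := hKsub (hK.sSup_mem hne)
  obtain ⟨s, has, hs⟩ := exists_between hinf.1
  have hsK : s < sSup K := hs.trans_le (csInf_le hK.bddBelow (hK.sSup_mem hne))
  have hKs : K ⊆ Ioc s (sSup K) := fun x hx =>
    ⟨hs.trans_le (csInf_le hK.bddBelow hx), le_csSup hK.bddAbove hx⟩
  refine (hcK.trans_le (measure_mono hKs)).not_ge ?_
  rw [← ofReal_measureReal]
  exact ENNReal.ofReal_le_ofReal (h s (sSup K) has hsK hsup.2)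

theorem real_Ioo_quantile_le {a b : ℝ} (hab : a ≤ b) :
    ρ.real (Ioo (quantile ρ a) (quantile ρ b)) ≤ b - a := by
  refine real_Ioo_le_of_forall_real_Ioc_le (sub_nonneg.2 hab) fun s s' hs hss' hs' => ?_
  have hlower : a ≤ ρ.real (Iic s) :=
    le_real_Iic_of_quantile_lt ((hss'.trans hs').le.trans (quantile_mem_Icc ρ b).2) hs
  have hupper : ρ.real (Iic s') < b := lt_of_not_ge fun h =>
    (quantile_le (((quantile_mem_Icc ρ a).1.trans hs.le).trans hss'.le) h).not_gt hs'
  have hsum : ρ.real (Iic s') = ρ.real (Iic s) + ρ.real (Ioc s s') := by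
    rw [← measureReal_union (Iic_disjoint_Ioc le_rfl) measurableSet_Ioc,
      Iic_union_Ioc_eq_Iic hss'.le]
  linarith

end Quantile

theorem sq_integral_le {α : Type*} [MeasurableSpace α] {μ : Measure α} [IsFiniteMeasure μ]
    {f : α → ℝ} (hf : MemLp f 2 μ) : (∫ x, f x ∂μ) ^ 2 ≤ μ.real univ * ∫ x, f x ^ 2 ∂μ := by
  have hint : Integrable f μ := hf.integrable one_le_two
  have hlinear (c : ℝ) : Integrable (fun x => f x ^ 2 - 2 * c * f x) μ :=
    hf.integrable_sq.sub (hint.const_mul _)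
  have hquad (c : ℝ) :
      0 ≤ μ.real univ * (c * c) + (-2 * ∫ x, f x ∂μ) * c + ∫ x, f x ^ 2 ∂μ := by
    calc 0 ≤ ∫ x, (f x ^ 2 - 2 * c * f x) + c ^ 2 ∂μ :=
          integral_nonneg fun x => (sq_nonneg (f x - c)).trans_eq (by ring)
      _ = _ := by
          rw [integral_add (hlinear c) (integrable_const _),
            integral_sub hf.integrable_sq (hint.const_mul _), integral_const_mul, integral_const,
            smul_eq_mul]
          ring
  have hdiscrim := discrim_le_zero hquad
  rw [discrim] at hdiscrim
  linarith

theorem integrableOn_sq (u : L2) : IntegrableOn (fun t => u t ^ 2) (Icc 0 1) :=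
  (Lp.memLp u).integrable_sq

theorem integral_sq_eq_norm_sq (u : L2) : ∫ t in Icc 0 1, u t ^ 2 = ‖u‖ ^ 2 := by
  rw [← real_inner_self_eq_norm_sq, MeasureTheory.L2.inner_def]
  simp only [RCLike.inner_apply, conj_trivial, sq]

theorem sq_inner_ind_le {u : L2} {a b x : ℝ} (ha : 0 ≤ a) (hb : b ≤ 1) (hx : x ∈ Ioo a b)
    (hua : ⟪ind a, u⟫ = 0) : ⟪ind x, u⟫ ^ 2 ≤ (b - a) * ∫ t in Ioc a b, u t ^ 2 := by
  have hx1 : x ≤ 1 := hx.2.le.trans hb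
  have hsub : Ioc a b ⊆ Icc 0 1 := fun t ht => ⟨ha.trans ht.1.le, ht.2.trans hb⟩
  have hsubx : Ioc a x ⊆ Ioc a b := Ioc_subset_Ioc_right hx.2.le
  have hincrement : ⟪ind x, u⟫ = ∫ t in Ioc a x, u t := by
    have hdisj : Disjoint (Icc 0 a) (Ioc a x) :=
      Set.disjoint_left.2 fun t ht ht' => ht'.1.not_ge ht.2
    rw [inner_ind hx1, ← Icc_union_Ioc_eq_Icc ha hx.1.le,
      setIntegral_union hdisj measurableSet_Ioc
        ((integrableOn_coeFn u).mono_set (Icc_subset_Icc_right (hx.1.le.trans hx1)))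
        ((integrableOn_coeFn u).mono_set (hsubx.trans hsub)),
      ← inner_ind (hx.1.le.trans hx1), hua, zero_add]
  calc ⟪ind x, u⟫ ^ 2
      ≤ (x - a) * ∫ t in Ioc a x, u t ^ 2 := by
        have h := sq_integral_le
          ((Lp.memLp u).mono_measure (Measure.restrict_mono (hsubx.trans hsub) le_rfl))
        rwa [measureReal_restrict_apply_univ, Real.volume_real_Ioc_of_le hx.1.le,
          ← hincrement] at h
    _ ≤ (b - a) * ∫ t in Ioc a b, u t ^ 2 := by
        gcongr ?_ * ?_
        · exact sub_nonneg.2 (hx.1.trans hx.2).le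
        · exact sub_le_sub_right hx.2.le a
        · exact setIntegral_mono_set ((integrableOn_sq u).mono_set hsub)
            (Eventually.of_forall fun t => sq_nonneg _) hsubx.eventuallyLE

theorem setIntegral_sq_inner_ind_le {ν : Measure ℝ} [IsFiniteMeasure ν] {u : L2} {a b : ℝ}
    (ha : 0 ≤ a) (hb : b ≤ 1) (hua : ⟪ind a, u⟫ = 0) (hub : ⟪ind b, u⟫ = 0) :
    ∫ y in Ioc a b, ⟪ind y, u⟫ ^ 2 ∂ν ≤
      ν.real (Ioo a b) * ((b - a) * ∫ t in Ioc a b, u t ^ 2) := by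
  have hopen : ∫ y in Ioc a b, ⟪ind y, u⟫ ^ 2 ∂ν = ∫ y in Ioo a b, ⟪ind y, u⟫ ^ 2 ∂ν := by
    refine setIntegral_eq_of_subset_of_forall_sdiff_eq_zero measurableSet_Ioc
      Ioo_subset_Ioc_self fun y hy => ?_
    have hyb : y = b := hy.1.2.eq_of_not_lt fun h => hy.2 ⟨hy.1.1, h⟩
    rw [hyb, hub, zero_pow two_ne_zero]
  rw [hopen, mul_comm]
  refine (Real.le_norm_self _).trans
    (norm_setIntegral_le_of_norm_le_const (measure_lt_top ν _) fun y hy => ?_)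
  rw [Real.norm_of_nonneg (sq_nonneg _)]
  exact sq_inner_ind_le ha hb hy hua

theorem inner_green_self_eq {ν : Measure ℝ} [IsFiniteMeasure ν] (hν : ν (Ioo 0 1)ᶜ = 0) {u : L2}
    (hu : u ∈ meanZero) : ⟪green ν u, u⟫ = ∫ y in (0 : ℝ)..1, ⟪ind y, u⟫ ^ 2 ∂ν := by
  have hae : ∀ᵐ y ∂ν, y ∈ Ioc (0 : ℝ) 1 := by
    filter_upwards [measure_eq_zero_iff_ae_notMem.1 hν] with y hy
    exact Ioo_subset_Ioc_self (not_not.1 hy)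
  rw [inner_green hν, intervalIntegral.integral_of_le zero_le_one,
    Measure.restrict_eq_self_of_ae_mem hae]
  simp only [inner_kern_eq_inner_ind hu, sq]

theorem inner_green_self_le {ν : Measure ℝ} [IsFiniteMeasure ν] (hν : ν (Ioo 0 1)ᶜ = 0)
    {t : ℕ → ℝ} (ht : Monotone t) {k : ℕ} (ht0 : t 0 = 0) (htk : t k = 1) {d : ℝ}
    (hlen : ∀ j, t (j + 1) - t j ≤ d) (hmass : ∀ j, ν.real (Ioo (t j) (t (j + 1))) ≤ d)
    {u : L2} (hz : ∀ j ≤ k, ⟪ind (t j), u⟫ = 0) : ⟪green ν u, u⟫ ≤ d ^ 2 * ‖u‖ ^ 2 := by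
  have hu : u ∈ meanZero := mem_meanZero.2 (by simpa only [htk] using hz k le_rfl)
  have hcell {j : ℕ} (hj : j < k) : ∫ y in t j..t (j + 1), ⟪ind y, u⟫ ^ 2 ∂ν ≤
      d ^ 2 * ∫ s in t j..t (j + 1), u s ^ 2 := by
    have hle := ht j.le_succ
    have hQ : 0 ≤ ∫ s in Ioc (t j) (t (j + 1)), u s ^ 2 := integral_nonneg fun _ => sq_nonneg _
    rw [intervalIntegral.integral_of_le hle, intervalIntegral.integral_of_le hle, sq d, mul_assoc]
    refine (setIntegral_sq_inner_ind_le (ht0 ▸ ht j.zero_le) (htk ▸ ht hj) (hz j hj.le)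
      (hz (j + 1) hj)).trans ?_
    have hd : 0 ≤ d := measureReal_nonneg.trans (hmass j)
    exact mul_le_mul (hmass j) (mul_le_mul_of_nonneg_right (hlen j) hQ)
      (mul_nonneg (sub_nonneg.2 hle) hQ) hd
  have hintν (j : ℕ) : IntervalIntegrable (fun y => ⟪ind y, u⟫ ^ 2) ν (t j) (t (j + 1)) :=
    ((continuous_ind.inner continuous_const).pow 2).intervalIntegrable _ _
  have hint {j : ℕ} (hj : j < k) :
      IntervalIntegrable (fun s => u s ^ 2) volume (t j) (t (j + 1)) :=
    (intervalIntegrable_iff_integrableOn_Icc_of_le (ht j.le_succ)).2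
      ((integrableOn_sq u).mono_set (Icc_subset_Icc (ht0 ▸ ht j.zero_le) (htk ▸ ht hj)))
  calc ⟪green ν u, u⟫
      = ∑ j ∈ Finset.range k, ∫ y in t j..t (j + 1), ⟪ind y, u⟫ ^ 2 ∂ν := by
        rw [intervalIntegral.sum_integral_adjacent_intervals fun j _ => hintν j, ht0, htk,
          inner_green_self_eq hν hu]
    _ ≤ ∑ j ∈ Finset.range k, d ^ 2 * ∫ s in t j..t (j + 1), u s ^ 2 :=
        Finset.sum_le_sum fun j hj => hcell (Finset.mem_range.1 hj)
    _ = d ^ 2 * ‖u‖ ^ 2 := by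
        rw [← Finset.mul_sum, intervalIntegral.sum_integral_adjacent_intervals fun j => hint, ht0,
          htk, intervalIntegral.integral_of_le zero_le_one, ← integral_Icc_eq_integral_Ioc,
          integral_sq_eq_norm_sq]

theorem exists_partition (ν : Measure ℝ) [IsFiniteMeasure ν] {m : ℕ} {d : ℝ} (hd : 0 < d)
    (hm : ν.real univ + 1 ≤ m * d) :
    ∃ t : ℕ → ℝ, Monotone t ∧ t 0 = 0 ∧ t (m + 1) = 1 ∧
      ∀ j, t (j + 1) - t j ≤ d ∧ ν.real (Ioo (t j) (t (j + 1))) ≤ d := by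
  set ρ : Measure ℝ := ν + volume.restrict (Ioo 0 1)
  have hmass : ρ.real univ < (m + 1 : ℕ) * d := by
    rw [measureReal_add_apply, measureReal_restrict_apply_univ,
      Real.volume_real_Ioo_of_le zero_le_one]
    push_cast
    linarith
  have hmono : Monotone fun j : ℕ => quantile ρ (j * d) := quantile_mono.comp
    fun i j hij => mul_le_mul_of_nonneg_right (Nat.cast_le.2 hij) hd.le
  refine ⟨fun j => quantile ρ (j * d), hmono, by simp [quantile_zero], quantile_eq_one hmass,
    fun j => ?_⟩
  have hsub : Ioo (quantile ρ (j * d)) (quantile ρ ((j + 1 : ℕ) * d)) ⊆ Ioo 0 1 :=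
    Ioo_subset_Ioo (quantile_mem_Icc ρ _).1 (quantile_mem_Icc ρ _).2
  have hcell := real_Ioo_quantile_le (ρ := ρ)
    (mul_le_mul_of_nonneg_right (Nat.cast_le (α := ℝ).2 j.le_succ) hd.le)
  rw [measureReal_add_apply, measureReal_restrict_apply measurableSet_Ioo, inter_eq_left.2 hsub,
    Real.volume_real_Ioo_of_le (hmono j.le_succ)] at hcell
  have hd' : ((j + 1 : ℕ) : ℝ) * d - j * d = d := by push_cast; ring
  constructor <;> linarith [hmono j.le_succ, measureReal_nonneg (μ := ν)
    (s := Ioo (quantile ρ (j * d)) (quantile ρ ((j + 1 : ℕ) * d)))]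

theorem eigenvalueCount_le {ν : Measure ℝ} [IsFiniteMeasure ν] (hν : ν (Ioo 0 1)ᶜ = 0)
    {m : ℕ} {d x : ℝ} (hd : 0 < d) (hm : ν.real univ + 1 ≤ m * d) (hx : 0 < x)
    (hxd : x * d ^ 2 < 1) : eigenvalueCount ν x ≤ (m + 1 : ℕ) := by
  obtain ⟨t, ht, ht0, ht1, hcell⟩ := exists_partition ν hd hm
  let values : L2 →ₗ[ℝ] (Fin (m + 1) → ℝ) :=
    LinearMap.pi fun j => (innerSL ℝ (ind (t (j + 1))) : L2 →ₗ[ℝ] ℝ)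
  have hvalues {u : L2} (hu : u ≠ 0) (h : values u = 0) : ⟪green ν u, u⟫ < x⁻¹ * ‖u‖ ^ 2 := by
    have hzero : ∀ j ≤ m + 1, ⟪ind (t j), u⟫ = 0
      | 0, _ => by rw [ht0, inner_ind zero_le_one]; simp
      | j + 1, hj => congrFun h ⟨j, hj⟩
    refine (inner_green_self_le hν ht ht0 ht1 (fun j => (hcell j).1) (fun j => (hcell j).2)
      hzero).trans_lt (mul_lt_mul_of_pos_right ?_ (by positivity))
    rwa [lt_inv_comm₀ (by positivity) hx, ← one_div, lt_div_iff₀ (by positivity)]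
  have hrank := toENat_rank_spectralSubspace_le (isSymmetric_green hν) values fun u => hvalues
  rw [rank_fin_fun, map_natCast] at hrank
  rw [eigenvalueCount_eq hν hx]
  exact_mod_cast ENat.toENNReal_le.2 hrank

/-! ### The lower bound on the eigenvalue count -/

/-- The derivative of the tent function on `[a,b]`, the piecewise linear function of slopes `1` and
`-1` that vanishes outside `(a,b)`. -/
noncomputable def tentDeriv (a b : ℝ) : L2 := (2 : ℝ) • kern ((a + b) / 2) - kern a - kern b

section Tent

variable {a b : ℝ}

theorem inner_kern_tentDeriv (hab : a ≤ b) (ha : 0 ≤ a) (hb : b ≤ 1) {y : ℝ}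
    (hy : y ∈ Icc (0 : ℝ) 1) : ⟪kern y, tentDeriv a b⟫ = max 0 (min (y - a) (b - y)) := by
  rw [tentDeriv, inner_sub_right, inner_sub_right, real_inner_smul_right,
    inner_kern_kern hy ⟨by linarith, by linarith⟩, inner_kern_kern hy ⟨ha, hab.trans hb⟩,
    inner_kern_kern hy ⟨ha.trans hab, hb⟩]
  grind

theorem norm_sq_tentDeriv (hab : a ≤ b) (ha : 0 ≤ a) (hb : b ≤ 1) :
    ‖tentDeriv a b‖ ^ 2 = b - a := by
  rw [← real_inner_self_eq_norm_sq]
  nth_rw 1 [tentDeriv]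
  rw [inner_sub_left, inner_sub_left, real_inner_smul_left,
    inner_kern_tentDeriv hab ha hb ⟨by linarith, by linarith⟩,
    inner_kern_tentDeriv hab ha hb ⟨ha, hab.trans hb⟩,
    inner_kern_tentDeriv hab ha hb ⟨ha.trans hab, hb⟩]
  grind

theorem inner_kern_tentDeriv_eq_zero (hab : a ≤ b) (ha : 0 ≤ a) (hb : b ≤ 1) {y : ℝ}
    (hy : y ∈ Icc (0 : ℝ) 1) (hyab : y ∉ Ioo a b) : ⟪kern y, tentDeriv a b⟫ = 0 := by
  rw [inner_kern_tentDeriv hab ha hb hy, max_eq_left]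
  rw [mem_Ioo] at hyab
  grind

theorem inner_tentDeriv_tentDeriv {a' b' : ℝ} (hab : a < b) (ha : 0 ≤ a) (hb : b ≤ 1)
    (hab' : a' ≤ b') (ha' : 0 ≤ a') (hb' : b' ≤ 1) (hdisj : Disjoint (Ioo a b) (Ioo a' b')) :
    ⟪tentDeriv a b, tentDeriv a' b'⟫ = 0 := by
  have hclosure : Disjoint (Icc a b) (Ioo a' b') := by
    simpa only [closure_Ioo hab.ne] using hdisj.closure_left isOpen_Ioo
  have hzero {y : ℝ} (hy : y ∈ Icc a b) : ⟪kern y, tentDeriv a' b'⟫ = 0 :=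
    inner_kern_tentDeriv_eq_zero hab' ha' hb' ⟨ha.trans hy.1, hy.2.trans hb⟩
      (disjoint_left.1 hclosure hy)
  rw [tentDeriv, inner_sub_left, inner_sub_left, real_inner_smul_left,
    hzero ⟨by linarith, by linarith⟩, hzero (left_mem_Icc.2 hab.le),
    hzero (right_mem_Icc.2 hab.le)]
  ring

theorem inner_green_tentDeriv_tentDeriv {ν : Measure ℝ} [IsFiniteMeasure ν]
    (hν : ν (Ioo 0 1)ᶜ = 0) {a' b' : ℝ} (hab : a ≤ b) (ha : 0 ≤ a) (hb : b ≤ 1) (hab' : a' ≤ b')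
    (ha' : 0 ≤ a') (hb' : b' ≤ 1) (hdisj : Disjoint (Ioo a b) (Ioo a' b')) :
    ⟪green ν (tentDeriv a b), tentDeriv a' b'⟫ = 0 := by
  rw [inner_green hν]
  refine integral_eq_zero_of_ae ?_
  filter_upwards [ae_mem_Icc hν] with y hy
  by_cases hyab : y ∈ Ioo a b
  · rw [inner_kern_tentDeriv_eq_zero hab' ha' hb' hy (disjoint_left.1 hdisj hyab), mul_zero,
      Pi.zero_apply]
  · rw [inner_kern_tentDeriv_eq_zero hab ha hb hy hyab, zero_mul, Pi.zero_apply]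

theorem sq_mul_real_Icc_le_inner_green_tentDeriv {ν : Measure ℝ} [IsFiniteMeasure ν]
    (hν : ν (Ioo 0 1)ᶜ = 0) (hab : a ≤ b) (ha : 0 ≤ a) (hb : b ≤ 1) {τ : ℝ} (hτ : 0 ≤ τ) :
    τ ^ 2 * ν.real (Icc (a + τ) (b - τ)) ≤ ⟪green ν (tentDeriv a b), tentDeriv a b⟫ := by
  rw [inner_green hν, mul_comm, ← smul_eq_mul, ← integral_indicator_const _ measurableSet_Icc]
  refine integral_mono_ae ((integrable_const _).indicator measurableSet_Icc)
    (integrable_of_continuous hν (by fun_prop)) ?_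
  filter_upwards [ae_mem_Icc hν] with y hy
  refine indicator_apply_le' (fun hyτ => ?_) fun _ => mul_self_nonneg _
  rw [← sq, inner_kern_tentDeriv hab ha hb hy]
  have : τ ≤ max 0 (min (y - a) (b - y)) :=
    le_max_of_le_right (le_min (by linarith [hyτ.1]) (by linarith [hyτ.2]))
  gcongr

theorem real_Ioc_le_real_Icc_add {ρ : Measure ℝ} (hρ : ρ ≤ volume) (a b : ℝ) {τ : ℝ}
    (hτ : 0 ≤ τ) : ρ.real (Ioc a b) ≤ ρ.real (Icc (a + τ) (b - τ)) + 2 * τ := by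
  have hvol {s : Set ℝ} (hs : volume s ≠ ∞) : ρ.real s ≤ volume.real s :=
    ENNReal.toReal_mono hs (hρ s)
  have hsub : Ioc a b ⊆ Icc (a + τ) (b - τ) ∪ (Icc a (a + τ) ∪ Icc (b - τ) b) := by
    intro x hx
    simp only [mem_union, mem_Icc]
    grind
  have hfin : volume (Icc (a + τ) (b - τ) ∪ (Icc a (a + τ) ∪ Icc (b - τ) b)) ≠ ∞ := by
    simp
  calc ρ.real (Ioc a b)
      ≤ ρ.real (Icc (a + τ) (b - τ)) + (ρ.real (Icc a (a + τ)) + ρ.real (Icc (b - τ) b)) :=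
        (measureReal_mono hsub ((hρ _).trans_lt hfin.lt_top).ne).trans
          ((measureReal_union_le _ _).trans
            (add_le_add_right (measureReal_union_le _ _) _))
    _ ≤ ρ.real (Icc (a + τ) (b - τ)) + (τ + τ) := by
        gcongr <;> refine (hvol measure_Icc_lt_top.ne).trans_eq ?_ <;>
          rw [Real.volume_real_Icc_of_le (by linarith)] <;> ring
    _ = _ := by ring

theorem le_inner_green_tentDeriv {ν ρ : Measure ℝ} [IsFiniteMeasure ν] (hν : ν (Ioo 0 1)ᶜ = 0)
    (hρν : ρ ≤ ν) (hρ : ρ ≤ volume) (hab : a ≤ b) (ha : 0 ≤ a) (hb : b ≤ 1) {κ : ℝ} (hκ : 0 ≤ κ)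
    (hdense : κ * (b - a) ≤ ρ.real (Ioc a b)) :
    κ ^ 3 / 32 * (b - a) ^ 3 ≤ ⟪green ν (tentDeriv a b), tentDeriv a b⟫ := by
  have hτ : 0 ≤ κ * (b - a) / 4 := by have := sub_nonneg.2 hab; positivity
  set τ := κ * (b - a) / 4 with hτ_def
  calc κ ^ 3 / 32 * (b - a) ^ 3 = τ ^ 2 * (κ * (b - a) / 2) := by rw [hτ_def]; ring
    _ ≤ τ ^ 2 * ρ.real (Icc (a + τ) (b - τ)) := by
        gcongr
        linarith [real_Ioc_le_real_Icc_add hρ a b hτ]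
    _ ≤ τ ^ 2 * ν.real (Icc (a + τ) (b - τ)) := by
        gcongr
        exact ENNReal.toReal_mono (measure_ne_top _ _) (hρν _)
    _ ≤ _ := sq_mul_real_Icc_le_inner_green_tentDeriv hν hab ha hb hτ

theorem card_le_eigenvalueCount {ν : Measure ℝ} [IsFiniteMeasure ν] (hν : ν (Ioo 0 1)ᶜ = 0)
    {ι : Type*} [Fintype ι] {a b : ι → ℝ} (hab : ∀ i, a i < b i) (ha : ∀ i, 0 ≤ a i)
    (hb : ∀ i, b i ≤ 1) (hdisj : Pairwise fun i j => Disjoint (Ioo (a i) (b i)) (Ioo (a j) (b j)))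
    {x : ℝ} (hx : 0 < x)
    (hform : ∀ i, b i - a i < x * ⟪green ν (tentDeriv (a i) (b i)), tentDeriv (a i) (b i)⟫) :
    Fintype.card ι ≤ eigenvalueCount ν x := by
  have hcard := card_le_toENat_rank_spectralSubspace (isSymmetric_green hν)
    (isCompactOperator_green hν) (u := fun i => tentDeriv (a i) (b i)) (c := x⁻¹)
    (fun i j hij => inner_tentDeriv_tentDeriv (hab i) (ha i) (hb i) (hab j).le (ha j) (hb j)
      (hdisj hij))
    (fun i j hij => inner_green_tentDeriv_tentDeriv hν (hab i).le (ha i) (hb i) (hab j).le (ha j)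
      (hb j) (hdisj hij))
    fun i => by
      rw [norm_sq_tentDeriv (hab i).le (ha i) (hb i), inv_mul_lt_iff₀ hx]
      exact hform i
  rw [eigenvalueCount_eq hν hx]
  exact_mod_cast ENat.toENNReal_le.2 hcard

end Tent

open Classical in
/-- The indices of the dyadic intervals of level `n` in `(0,1]` on which `ρ` has mean density at
least `κ`. -/
noncomputable def denseIndices (ρ : Measure ℝ) (κ : ℝ) (n : ℕ) : Finset ℕ :=
  (Finset.Icc 1 (2 ^ n)).filter fun k => κ * ((2 : ℝ) ^ n)⁻¹ ≤ ρ.real (dyadic n k)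

theorem le_card_denseIndices {ρ : Measure ℝ} [IsFiniteMeasure ρ] (hρ : ρ ≤ volume) {κ : ℝ}
    (hκ : 0 ≤ κ) (n : ℕ) : (ρ.real (Ioc 0 1) - κ) * 2 ^ n ≤ (denseIndices ρ κ n).card := by
  classical
  have h2 : (0 : ℝ) < 2 ^ n := by positivity
  have hterm : ∀ k ∈ Finset.Icc 1 (2 ^ n), ρ.real (dyadic n k) ≤
      κ * ((2 : ℝ) ^ n)⁻¹ + if k ∈ denseIndices ρ κ n then ((2 : ℝ) ^ n)⁻¹ else 0 := by
    intro k hk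
    split_ifs with h
    · have hvol : ρ.real (dyadic n k) ≤ ((2 : ℝ) ^ n)⁻¹ := by
        rw [← volume_real_dyadic n k]
        exact ENNReal.toReal_mono measure_Ioc_lt_top.ne (hρ _)
      exact hvol.trans (le_add_of_nonneg_left (by positivity))
    · rw [denseIndices, Finset.mem_filter, not_and, not_le] at h
      simpa using (h hk).le
  have hsub : denseIndices ρ κ n ⊆ Finset.Icc 1 (2 ^ n) := Finset.filter_subset _ _
  have hsum := Finset.sum_le_sum hterm
  rw [sum_real_dyadic, Finset.sum_add_distrib, Finset.sum_const, Nat.card_Icc, Nat.add_sub_cancel,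
    Finset.sum_ite_mem, Finset.inter_eq_right.2 hsub, Finset.sum_const, nsmul_eq_mul,
    nsmul_eq_mul, Nat.cast_pow, Nat.cast_ofNat, mul_left_comm, mul_inv_cancel₀ h2.ne', mul_one,
    ← sub_le_iff_le_add', ← div_eq_mul_inv, le_div_iff₀ h2] at hsum
  exact hsum

theorem le_eigenvalueCount {ν ρ : Measure ℝ} [IsFiniteMeasure ν] [IsFiniteMeasure ρ]
    (hν : ν (Ioo 0 1)ᶜ = 0) (hρν : ρ ≤ ν) (hρ : ρ ≤ volume) {κ x : ℝ} (hκ : 0 ≤ κ) (hx : 0 < x)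
    {n : ℕ} (hxn : 32 * (2 ^ n) ^ 2 < κ ^ 3 * x) :
    ENNReal.ofReal ((ρ.real (Ioc 0 1) - κ) * 2 ^ n) ≤ eigenvalueCount ν x := by
  classical
  let J := denseIndices ρ κ n
  let a : J → ℝ := fun k => ((k : ℕ) - 1) / 2 ^ n
  let b : J → ℝ := fun k => (k : ℕ) / 2 ^ n
  have hlen (k : J) : b k - a k = ((2 : ℝ) ^ n)⁻¹ := by simp only [a, b]; ring
  have hab (k : J) : a k < b k := sub_pos.1 (by rw [hlen k]; positivity)
  have hk (k : J) : (1 : ℝ) ≤ (k : ℕ) ∧ ((k : ℕ) : ℝ) ≤ 2 ^ n := by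
    exact_mod_cast Finset.mem_Icc.1 (Finset.mem_filter.1 k.2).1
  have ha (k : J) : 0 ≤ a k := div_nonneg (sub_nonneg.2 (hk k).1) (by positivity)
  have hb (k : J) : b k ≤ 1 := div_le_one_of_le₀ (hk k).2 (by positivity)
  have hdisj : Pairwise fun j k => Disjoint (Ioo (a j) (b j)) (Ioo (a k) (b k)) := fun j k hjk =>
    (pairwise_disjoint_dyadic n (Subtype.coe_ne_coe.2 hjk)).mono Ioo_subset_Ioc_self
      Ioo_subset_Ioc_self
  have hform (k : J) :
      b k - a k < x * ⟪green ν (tentDeriv (a k) (b k)), tentDeriv (a k) (b k)⟫ := by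
    have hdense : κ * (b k - a k) ≤ ρ.real (Ioc (a k) (b k)) := by
      rw [hlen k]
      exact (Finset.mem_filter.1 k.2).2
    refine lt_of_lt_of_le ?_ (mul_le_mul_of_nonneg_left
      (le_inner_green_tentDeriv hν hρν hρ (hab k).le (ha k) (hb k) hκ hdense) hx.le)
    rw [hlen k]
    field_simp
    linarith
  calc ENNReal.ofReal ((ρ.real (Ioc 0 1) - κ) * 2 ^ n) ≤ Fintype.card J := by
        rw [Fintype.card_coe, ← ENNReal.ofReal_natCast]
        exact ENNReal.ofReal_le_ofReal (le_card_denseIndices hρ hκ n)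
    _ ≤ _ := card_le_eigenvalueCount hν hab ha hb hdisj hx hform

/-! ### The spectral dimension -/

section SpectralDim

variable {ν : Measure ℝ} [IsFiniteMeasure ν]

theorem eigenvalueCount_le_mul_sqrt (hν : ν (Ioo 0 1)ᶜ = 0) {x : ℝ} (hx : 1 ≤ x) :
    eigenvalueCount ν x ≤ ENNReal.ofReal ((ν.real univ + 3) * √x) := by
  set M := ν.real univ
  have hx0 : 0 < x := one_pos.trans_le hx
  have : 0 ≤ M := measureReal_nonneg
  have hsqrt : 1 ≤ √x := Real.one_le_sqrt.2 hx
  have hr : 0 < √x * (M + 1) := by positivity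
  set m := ⌊√x * (M + 1)⌋₊ + 1
  have hm : √x * (M + 1) < m := by
    push_cast [m]
    exact Nat.lt_floor_add_one _
  have hm' : (m : ℝ) ≤ √x * (M + 1) + 1 := by
    push_cast [m]
    linarith [Nat.floor_le hr.le]
  have hm0 : (0 : ℝ) < m := hr.trans hm
  have hscale : x * ((M + 1) / m) ^ 2 < 1 := by
    calc x * ((M + 1) / m) ^ 2 = (√x * (M + 1) / m) ^ 2 := by
          rw [div_pow, div_pow, mul_pow, Real.sq_sqrt hx0.le]
          ring
      _ < 1 := pow_lt_one₀ (by positivity) ((div_lt_one hm0).2 hm) two_ne_zero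
  refine (eigenvalueCount_le hν (d := (M + 1) / m) (by positivity)
    (mul_div_cancel₀ _ hm0.ne').ge hx0 hscale).trans ?_
  rw [← ENNReal.ofReal_natCast]
  refine ENNReal.ofReal_le_ofReal ?_
  push_cast
  linarith

variable {ρ : Measure ℝ} [IsFiniteMeasure ρ]

theorem exists_mul_sqrt_le_eigenvalueCount (hν : ν (Ioo 0 1)ᶜ = 0) (hρν : ρ ≤ ν)
    (hρ : ρ ≤ volume) (hρ0 : 0 < ρ.real (Ioc 0 1)) :
    ∃ A > 0, ∀ᶠ x : ℝ in atTop, ENNReal.ofReal (A * √x) ≤ eigenvalueCount ν x := by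
  set κ := ρ.real (Ioc 0 1) / 2 with hκ_def
  have hκ : 0 < κ := half_pos hρ0
  refine ⟨κ * √(κ ^ 3 / 64) / 2, by positivity, ?_⟩
  filter_upwards [eventually_gt_atTop 0, eventually_ge_atTop (κ ^ 3 / 64)⁻¹] with x hx hxκ
  have hscale : 1 ≤ √(κ ^ 3 / 64 * x) :=
    Real.one_le_sqrt.2 ((inv_le_iff_one_le_mul₀' (by positivity)).1 hxκ)
  obtain ⟨n, hn, hn'⟩ := exists_nat_pow_near hscale one_lt_two
  have hn2 : ((2 : ℝ) ^ n) ^ 2 ≤ κ ^ 3 / 64 * x := (Real.le_sqrt' (by positivity)).1 hn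
  refine le_trans (ENNReal.ofReal_le_ofReal ?_)
    (le_eigenvalueCount hν hρν hρ hκ.le hx (n := n) ?_)
  · rw [Real.sqrt_mul (by positivity), pow_succ 2] at hn'
    calc κ * √(κ ^ 3 / 64) / 2 * √x = κ * (√(κ ^ 3 / 64) * √x / 2) := by ring
      _ ≤ κ * 2 ^ n := by gcongr; linarith
      _ = (ρ.real (Ioc 0 1) - κ) * 2 ^ n := by rw [hκ_def]; ring
  · have : 0 < ((2 : ℝ) ^ n) ^ 2 := by positivity
    linarith

theorem hasSpectralDim (hν : ν (Ioo 0 1)ᶜ = 0) (hρν : ρ ≤ ν) (hρ : ρ ≤ volume)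
    (hρ0 : 0 < ρ.real (Ioc 0 1)) : HasSpectralDim ν (1 / 2) := by
  obtain ⟨A, hA, hlower⟩ := exists_mul_sqrt_le_eigenvalueCount hν hρν hρ hρ0
  have hupper : ∀ᶠ x in atTop,
      eigenvalueCount ν x ≤ ENNReal.ofReal ((ν.real univ + 3) * √x) :=
    (eventually_ge_atTop 1).mono fun x hx => eigenvalueCount_le_mul_sqrt hν hx
  have hfinite : ∀ᶠ x in atTop, eigenvalueCount ν x ≠ ∞ :=
    hupper.mono fun x hx => (hx.trans_lt ENNReal.ofReal_lt_top).ne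
  have hlog : Tendsto (fun x => Real.log (eigenvalueCount ν x).toReal / Real.log x) atTop
      (𝓝 (1 / 2)) := by
    refine tendsto_log_div_log_of_rpow_bounds (B := ν.real univ + 3) tendsto_id hA ?_ ?_
    · filter_upwards [hlower, hfinite] with x hx hfin
      rw [← Real.sqrt_eq_rpow]
      exact (ENNReal.ofReal_le_iff_le_toReal hfin).1 hx
    · filter_upwards [hupper] with x hx
      rw [← Real.sqrt_eq_rpow]
      exact ENNReal.toReal_le_of_le_ofReal (by positivity) hx
  have hlim : Tendsto (fun x => ENNReal.log (eigenvalueCount ν x) / (Real.log x : EReal)) atTop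
      (𝓝 ((1 / 2 : ℝ) : EReal)) := by
    refine ((continuous_coe_real_ereal.tendsto _).comp hlog).congr' ?_
    filter_upwards [hlower, hfinite, eventually_gt_atTop 0] with x hx hfin hx0
    have hpos : 0 < eigenvalueCount ν x :=
      (ENNReal.ofReal_pos.2 (by positivity)).trans_le hx
    rw [Function.comp_apply, ENNReal.log_pos_real hpos.ne' hfin, EReal.coe_div]
  exact ⟨hlim.liminf_eq, hlim.limsup_eq⟩

end SpectralDim

end KreinFeller

theorem corollary1p3 (ν : MeasureTheory.Measure ℝ) [MeasureTheory.IsFiniteMeasure ν]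
    (hν : ν (Set.Ioo (0 : ℝ) 1)ᶜ = 0)
    (hac : MeasureTheory.volume.withDensity (ν.rnDeriv MeasureTheory.volume) ≠ 0) :
    (∀ q ∈ Set.Icc (0 : ℝ) 1,
      Filter.Tendsto (fun n : ℕ => KreinFeller.betaLevel ν n q) Filter.atTop (nhds (1 - q)) ∧
        KreinFeller.lqSpectrum ν q = ((1 - q : ℝ) : EReal)) ∧
    KreinFeller.IsLqRegular ν ∧
    KreinFeller.HasSpectralDim ν (1 / 2) := by
  obtain ⟨ρ, hρν, hρ, hρ0⟩ := KreinFeller.exists_lebesgue_minorant hν hac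
  have := isFiniteMeasure_of_le ν hρν
  exact ⟨fun q hq => ⟨KreinFeller.tendsto_betaLevel hρν hρ hρ0 hq,
      (KreinFeller.tendsto_coe_betaLevel hρν hρ hρ0 hq).limsup_eq⟩,
    KreinFeller.isLqRegular hρν hρ hρ0, KreinFeller.hasSpectralDim hν hρν hρ hρ0⟩
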